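/- Let $F=M_{r_1}\oplus\dots\oplus M_{r_s}$ be a finite-dimensional $C^*$-algebra and $A$ a $C^*$-algebra. A completely positive map $\varphi:F\to A$ has *strict order zero* if $\varphi(e_0)\varphi(e_1)=0$ for any two orthogonal minimal projections $e_0,e_1\in F$. It is *$n$-decomposable* ($n\in\{0,1,2,\dots\}$) if $\{1,\dots,s\}$ can be written as a disjoint union $I_0\sqcup\dots\sqcup I_n$ (some $I_j$ may be empty) such that the restriction of $\varphi$ to $\bigoplus_{i\in I_j}M_{r_i}$ has strict order zero for each $j$. The *decomposition rank* $\mathrm{dr}\,A$ of a separable $C^*$-algebra $A$ is the least integer $n\ge 0$ such that for all $b_1,\dots,b_m\in A$ and all $\varepsilon>0$ there are a finite-dimensional $C^*$-algebra $F=M_{r_1}\oplus\dots\oplus M_{r_s}$ and completely positive contractions $\psi:A\to F$ and $\varphi:F\to A$ such that $\varphi$ is $n$-decomposable and $\|\varphi(\psi(b_k))-b_k\|<\varepsilon$ for $k=1,\dots,m$; if there is no such $n$, then $\mathrm{dr}\,A=\infty$. **Proposition 3.10.** Let $A$ be a separable $C^*$-algebra (not necessarily unital) and let $B\subset A$ be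 a hereditary $C^*$-subalgebra, i.e. a norm-closed $*$-subalgebra such that $a\in B$ whenever $a\in A$, $b\in B$ and $0\le a\le b$. Then $\mathrm{dr}\,B\le\mathrm{dr}\,A$. -/

import Mathlib

noncomputable section

namespace DecompositionRank

open scoped ComplexOrder CStarAlgebra

/-- The finite-dimensional C*-algebra `M_{r 0} ⊕ ⋯ ⊕ M_{r (s-1)}`, with the sup of the operator
norms of the summands and with coordinatewise operations and order. (Blocks of size `0` are the
zero algebra and contribute nothing; for `s = 0` one gets the zero algebra.) -/
abbrev MatrixSum {ι : Type} (r : ι → ℕ) : Type :=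
  (i : ι) → CStarMatrix (Fin (r i)) (Fin (r i)) ℂ

/-- The embedding of the partial sum `⨁_{i ∈ I} M_{r i}` into `⨁_i M_{r i}`, extending by zero. -/
def extendByZero {s : ℕ} (r : Fin s → ℕ) (I : Set (Fin s))
    (x : MatrixSum (fun i : I => r i)) : MatrixSum r :=
  open Classical in fun i => if h : i ∈ I then x ⟨i, h⟩ else 0

/-- `e` is a minimal projection: a nonzero projection whose only subprojections are `0` and `e`. -/
def IsMinimalProjection {F : Type*} [NonUnitalCStarAlgebra F] (e : F) : Prop :=
  IsStarProjection e ∧ e ≠ 0 ∧ ∀ f : F, IsStarProjection f → e * f = f → f = 0 ∨ f = e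

/-- A (completely positive) map `φ` on a finite-dimensional C*-algebra `F` has strict order at
most `n`: among any `n + 2` pairwise orthogonal minimal projections of `F` there are two with
orthogonal images. (The images are positive, so `a ⊥ b` means `a * b = 0`.) -/
def StrictOrderLE {F A : Type*} [NonUnitalCStarAlgebra F] [NonUnitalCStarAlgebra A]
    (n : ℕ) (φ : F → A) : Prop :=
  ∀ e : Fin (n + 2) → F, (∀ i, IsMinimalProjection (e i)) →
    (∀ i j, i ≠ j → e i * e j = 0) → ∃ i j, i ≠ j ∧ φ (e i) * φ (e j) = 0

/-- A (completely positive) map `φ : ⨁_i M_{r i} → A` is `n`-decomposable: the index set is a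
disjoint union of `I_0, …, I_n` (the fibres of `c`) such that the restriction of `φ` to each
`⨁_{i ∈ I_j} M_{r i}` has strict order zero. -/
def IsDecomposable {A : Type*} [NonUnitalCStarAlgebra A] {s : ℕ} {r : Fin s → ℕ}
    (n : ℕ) (φ : MatrixSum r → A) : Prop :=
  ∃ c : Fin s → Fin (n + 1), ∀ j : Fin (n + 1),
    StrictOrderLE 0 (φ ∘ extendByZero r {i | c i = j})

/-- Every finite subset of `A` has, within every `ε > 0`, an approximation `(F, ψ, φ)` through
completely positive contractions `ψ : A → F`, `φ : F → A`, with `F` a finite-dimensional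
C*-algebra and `φ` being `n`-decomposable. The order on `A` is its usual C*-algebra order. -/
def HasDecomposableApproximations (A : Type*) [NonUnitalCStarAlgebra A] (n : ℕ) : Prop :=
  letI : PartialOrder A := CStarAlgebra.spectralOrder A
  haveI : StarOrderedRing A := CStarAlgebra.spectralOrderedRing A
  ∀ (S : Finset A) (ε : ℝ), 0 < ε →
    ∃ (s : ℕ) (r : Fin s → ℕ) (ψ : A →CP MatrixSum r) (φ : MatrixSum r →CP A),
      (∀ a, ‖ψ a‖ ≤ ‖a‖) ∧ (∀ x, ‖φ x‖ ≤ ‖x‖) ∧ IsDecomposable n φ ∧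
        ∀ b ∈ S, ‖φ (ψ b) - b‖ < ε

/-- The decomposition rank of `A`: the least `n` such that `A` has `n`-decomposable completely
positive approximations, and `⊤` if there is no such `n`. -/
def decompositionRank (A : Type*) [NonUnitalCStarAlgebra A] : ℕ∞ :=
  ⨅ (n : ℕ) (_ : HasDecomposableApproximations A n), (n : ℕ∞)

/-- `B` is hereditary in `A`: if `0 ≤ a ≤ b` with `a` in `A` and `b` in `B`, then `a` is in `B`. -/
def IsHereditary {A : Type*} [NonUnitalCStarAlgebra A] (B : NonUnitalStarSubalgebra ℂ A) : Prop :=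
  letI : PartialOrder A := CStarAlgebra.spectralOrder A
  ∀ a b : A, 0 ≤ a → a ≤ b → b ∈ B → a ∈ B

end DecompositionRank

end

/-! Let `ι : B → A` be the inclusion. Every element of `B` is a combination of four positive ones,
so it suffices to approximate a finite set of positive elements of `B`. Let `h` be their sum and let
`q` in `B` be an almost unit for `h`. Take an `n`-decomposable approximation `(F, ψ, φ)` in `A` that
is accurate on `h` as well as on the given elements, and cut `F` down to the corner under the
spectral projection `p` of `ψ h` for `[κ, ∞)`. Cutting costs little, because every given `b` has `ψ
b ≤ ψ h`. In return `κ • φ p ≤ φ (ψ h) ≈ h`, so `q` almost fixes everything below `φ p`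
(`exists_corner`, `norm_sub_mul_le_of_le_image`).

It remains to push each colour `θ` of `φ` into `B` while keeping order zero exactly; compressing by
`q` would destroy it. Strict order zero makes `θ e` commute with `a = θ u`, where `u` is the unit
(`commute_map_unit_of_strictOrderZero`). If `star z * z` is a function of `a`, then `θ e * θ f = 0`
gives `z θ(e) z* z θ(f) z* = z θ(e) θ(f) z* z z* = 0`. Such a `z` exists in the closed right ideal
of `q`, close to an almost unit for `a` (`exists_twist`, by a polar decomposition argument).
Heredity places `z x z*` in `B`. Summing over the colours and rescaling to a contraction gives the
new map (`exists_decomposable_into_hereditary`). -/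

noncomputable section

namespace DecompositionRank

open scoped ComplexOrder CStarAlgebra Matrix
open Filter Topology

/-! ### Norm estimates and functional calculus in a nonunital C*-algebra -/

section Generalities

variable {A : Type*} [NonUnitalCStarAlgebra A] [PartialOrder A] [StarOrderedRing A]

/-- Functional calculus commutes with `ι`, so the negative part of `c` is sent to that of `ι c`,
which vanishes. -/
theorem nonneg_of_map_nonneg {C D : Type*} [NonUnitalCStarAlgebra C] [PartialOrder C]
    [StarOrderedRing C] [NonUnitalCStarAlgebra D] [PartialOrder D] [StarOrderedRing D]
    (ι : C →⋆ₙₐ[ℂ] D) (hι : Function.Injective ι) {c : C} (h : 0 ≤ ι c) : 0 ≤ c := by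
  have hsa : IsSelfAdjoint c := hι (by rw [map_star]; exact (IsSelfAdjoint.of_nonneg h).star_eq)
  have hι' : Continuous ι := (NonUnitalStarAlgHom.isometry ι hι).continuous
  rw [← CFC.negPart_eq_zero_iff c]
  apply hι
  rw [map_zero, CFC.negPart_def,
    NonUnitalStarAlgHomClass.map_cfcₙ (S := ℂ) ι _ c (hφ := hι') (hφa := hsa.map ι)]
  exact (CFC.negPart_eq_zero_iff _).2 h

open CFC in
-- The right-hand side is the norm of `(1 - q) y (1 - q)`, written without a unit; the same
-- expression measures "`q` is almost a unit for `y`" throughout. In the unitization the left-hand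
-- side is the norm of `(1 - q) c (1 - q)`, and conjugation is monotone.
theorem norm_sqrt_sub_mul_sqrt_sq_le {c y q : A} (hc : 0 ≤ c) (hcy : c ≤ y)
    (hq : IsSelfAdjoint q) :
    ‖sqrt c - q * sqrt c‖ ^ 2 ≤ ‖y - q * y - y * q + q * y * q‖ := by
  have hs : sqrt c * sqrt c = c := sqrt_mul_sqrt_self c
  have hss : star (sqrt c) = sqrt c := (sqrt_nonneg c).isSelfAdjoint.star_eq
  have h1 : (sqrt c - q * sqrt c) * star (sqrt c - q * sqrt c) = c - q * c - c * q + q * c * q := by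
    rw [star_sub, star_mul, hss, hq.star_eq]
    simp only [sub_mul, mul_sub]
    rw [← mul_assoc, hs, mul_assoc q, hs, mul_assoc q, ← mul_assoc (sqrt c), hs, ← mul_assoc]
    abel
  have key (w : A) : ((w - q * w - w * q + q * w * q : A) : Unitization ℂ A) =
      (1 - (q : Unitization ℂ A)) * w * (1 - (q : Unitization ℂ A)) := by
    simp only [Unitization.inr_sub, Unitization.inr_add, Unitization.inr_mul]
    noncomm_ring
  have hsa : IsSelfAdjoint (1 - (q : Unitization ℂ A)) := (IsSelfAdjoint.one _).sub (hq.inr ℂ)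
  rw [sq, ← CStarRing.norm_self_mul_star, h1, ← Unitization.norm_inr (𝕜 := ℂ), ← Unitization.norm_inr (𝕜 := ℂ) (_ + _),
    key, key]
  have hc' : 0 ≤ (c : Unitization ℂ A) := Unitization.inr_nonneg_iff.2 hc
  have hcy' : (c : Unitization ℂ A) ≤ y :=
    (Unitization.inr_le_iff c y hc.isSelfAdjoint (hc.trans hcy).isSelfAdjoint).2 hcy
  refine CStarAlgebra.norm_le_norm_of_nonneg_of_le ?_ ?_
  · exact hsa.conjugate_nonneg hc'
  · exact hsa.conjugate_le_conjugate hcy'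

open CFC in
theorem norm_sub_mul_sq_le {c y q : A} (hc : 0 ≤ c) (hcy : c ≤ y) (hq : IsSelfAdjoint q) :
    ‖c - q * c‖ ^ 2 ≤ ‖c‖ * ‖y - q * y - y * q + q * y * q‖ := by
  have hs : sqrt c * sqrt c = c := sqrt_mul_sqrt_self c
  have h1 : c - q * c = (sqrt c - q * sqrt c) * sqrt c := by
    rw [sub_mul, mul_assoc, hs]
  have h2 : ‖sqrt c‖ ^ 2 = ‖c‖ := by
    rw [sq, ← CStarRing.norm_star_mul_self, (sqrt_nonneg c).isSelfAdjoint.star_eq, hs]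
  have h3 := norm_sqrt_sub_mul_sqrt_sq_le hc hcy hq
  calc ‖c - q * c‖ ^ 2 ≤ (‖sqrt c - q * sqrt c‖ * ‖sqrt c‖) ^ 2 := by
        rw [h1]; gcongr; exact norm_mul_le _ _
    _ = ‖c‖ * ‖sqrt c - q * sqrt c‖ ^ 2 := by rw [mul_pow, h2, mul_comm]
    _ ≤ _ := by gcongr

theorem norm_sub_mul_mul_le {A : Type*} [NonUnitalCStarAlgebra A] {c q : A} (hc : IsSelfAdjoint c) (hq : IsSelfAdjoint q) (hq1 : ‖q‖ ≤ 1) :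
    ‖c - q * c * q‖ ≤ 2 * ‖c - q * c‖ := by
  have h1 : c - q * c * q = (c - q * c) + q * star (c - q * c) := by
    rw [star_sub, star_mul, hc.star_eq, hq.star_eq, mul_sub, ← mul_assoc]; abel
  rw [h1]
  refine (norm_add_le _ _).trans ?_
  have := norm_mul_le q (star (c - q * c))
  rw [norm_star] at this
  nlinarith [norm_nonneg (c - q * c)]

open CFC in
-- `c ≤ y + δ² ≤ (√y + δ)²`, and the square root is operator monotone.
theorem sqrt_le_sqrt_add {C : Type*} [CStarAlgebra C] [PartialOrder C] [StarOrderedRing C]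
    {c y : C} (hc : 0 ≤ c) (hy : 0 ≤ y) {δ : ℝ} (hδ : 0 ≤ δ) (h : ‖c - y‖ ≤ δ ^ 2) :
    sqrt c ≤ sqrt y + algebraMap ℝ C δ := by
  have h0 : 0 ≤ sqrt y + algebraMap ℝ C δ := add_nonneg (sqrt_nonneg y) (algebraMap_nonneg C hδ)
  have h1 : c ≤ (sqrt y + algebraMap ℝ C δ) * (sqrt y + algebraMap ℝ C δ) := by
    have h2 : c - y ≤ algebraMap ℝ C (δ ^ 2) :=
      ((hc.isSelfAdjoint.sub hy.isSelfAdjoint).le_algebraMap_norm_self).trans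
        (algebraMap_mono C h)
    have h3 : (sqrt y + algebraMap ℝ C δ) * (sqrt y + algebraMap ℝ C δ) =
        y + algebraMap ℝ C (δ ^ 2) + (2 * δ) • sqrt y := by
      rw [mul_add, add_mul, add_mul, sqrt_mul_sqrt_self y, ← map_mul,
        Algebra.algebraMap_eq_smul_one, Algebra.algebraMap_eq_smul_one]
      simp only [smul_mul_assoc, mul_smul_comm, one_mul, mul_one, sq, two_mul, add_smul,
        Algebra.algebraMap_eq_smul_one]
      abel
    rw [h3]
    calc c = y + (c - y) := by abel
      _ ≤ y + algebraMap ℝ C (δ ^ 2) := by gcongr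
      _ ≤ _ := le_add_of_nonneg_right (smul_nonneg (by positivity) (sqrt_nonneg y))
  calc sqrt c ≤ sqrt _ := sqrt_le_sqrt _ _ h1
    _ = _ := sqrt_mul_self _ h0

open CFC in
theorem norm_sqrt_sub_sqrt_le {c y : A} (hc : 0 ≤ c) (hy : 0 ≤ y) {δ : ℝ} (hδ : 0 ≤ δ)
    (h : ‖c - y‖ ≤ δ ^ 2) : ‖sqrt c - sqrt y‖ ≤ δ := by
  have hc' : 0 ≤ (c : Unitization ℂ A) := Unitization.inr_nonneg_iff.2 hc
  have hy' : 0 ≤ (y : Unitization ℂ A) := Unitization.inr_nonneg_iff.2 hy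
  have h' : ‖(c : Unitization ℂ A) - y‖ ≤ δ ^ 2 := by
    rw [← Unitization.inr_sub, Unitization.norm_inr]; exact h
  rw [← Unitization.norm_inr (𝕜 := ℂ), Unitization.inr_sub, ← Unitization.sqrt_inr,
    ← Unitization.sqrt_inr]
  have h1 := sqrt_le_sqrt_add hc' hy' hδ h'
  have h2 := sqrt_le_sqrt_add hy' hc' hδ (by rwa [norm_sub_rev])
  have hsa : IsSelfAdjoint (sqrt (c : Unitization ℂ A) - sqrt (y : Unitization ℂ A)) :=
    (sqrt_nonneg _).isSelfAdjoint.sub (sqrt_nonneg _).isSelfAdjoint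
  have h3 : sqrt (c : Unitization ℂ A) - sqrt (y : Unitization ℂ A) ≤ algebraMap ℝ _ δ :=
    sub_le_iff_le_add'.2 h1
  have h4 : algebraMap ℝ _ (-δ) ≤ sqrt (c : Unitization ℂ A) - sqrt (y : Unitization ℂ A) := by
    rw [map_neg, neg_le, neg_sub]
    exact sub_le_iff_le_add'.2 h2
  rw [le_algebraMap_iff_spectrum_le] at h3
  rw [algebraMap_le_iff_le_spectrum] at h4
  rcases CStarAlgebra.norm_or_neg_norm_mem_spectrum hsa with h5 | h5
  · exact h3 _ h5
  · exact neg_le_neg_iff.1 (h4 _ h5)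

theorem norm_mul_eq_norm_sqrt_mul (g w : A) : ‖g * w‖ = ‖CFC.sqrt (star g * g) * w‖ := by
  have hy : 0 ≤ star g * g := star_mul_self_nonneg g
  have hs : star (CFC.sqrt (star g * g)) = CFC.sqrt (star g * g) :=
    (CFC.sqrt_nonneg _).isSelfAdjoint.star_eq
  have h : star (g * w) * (g * w) =
      star (CFC.sqrt (star g * g) * w) * (CFC.sqrt (star g * g) * w) := by
    rw [star_mul, star_mul, hs, mul_assoc, mul_assoc, ← mul_assoc _ (CFC.sqrt _) w,
      CFC.sqrt_mul_sqrt_self _ hy, mul_assoc]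
  rw [← sq_eq_sq₀ (norm_nonneg _) (norm_nonneg _), sq, sq, ← CStarRing.norm_star_mul_self,
    ← CStarRing.norm_star_mul_self, h]

theorem norm_sub_cfcₙ_conjugate_le {y : A} (hy : 0 ≤ y) {k : ℝ → ℝ}
    (hk : ContinuousOn k (quasispectrum ℝ y)) (hk0 : k 0 = 0) {s : ℝ} (hs : ∀ t, 0 ≤ t → |t * (1 - k t) ^ 2| ≤ s) :
    ‖y - cfcₙ k y * y - y * cfcₙ k y + cfcₙ k y * y * cfcₙ k y‖ ≤ s := by
  have hsa : IsSelfAdjoint y := hy.isSelfAdjoint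
  have h1 : y - cfcₙ k y * y - y * cfcₙ k y + cfcₙ k y * y * cfcₙ k y =
      cfcₙ (fun t => t - k t * t - t * k t + k t * t * k t) y := by
    rw [cfcₙ_add (fun t => t - k t * t - t * k t) (fun t => k t * t * k t) y,
      cfcₙ_sub (fun t => t - k t * t) (fun t => t * k t) y,
      cfcₙ_sub (fun t => t) (fun t => k t * t) y,
      cfcₙ_mul (fun t => k t * t) (fun t => k t) y, cfcₙ_mul (fun t => k t) (fun t => t) y,
      cfcₙ_mul (fun t => t) (fun t => k t) y, cfcₙ_id' ℝ y]
  rw [h1]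
  refine norm_cfcₙ_le fun t ht => ?_
  have ht0 : 0 ≤ t := quasispectrum_nonneg_of_nonneg y hy t ht
  rw [Real.norm_eq_abs]
  convert hs t ht0 using 2
  ring

theorem abs_mul_one_sub_div_sq_le {t s : ℝ} (ht : 0 ≤ t) (hs : 0 < s) :
    |t * (1 - |t| / (|t| + s)) ^ 2| ≤ s := by
  have h1 : 1 - |t| / (|t| + s) = s / (t + s) := by
    rw [abs_of_nonneg ht]; field_simp; ring
  rw [h1, abs_of_nonneg (by positivity), div_pow, ← mul_div_assoc, div_le_iff₀ (by positivity)]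
  nlinarith [mul_nonneg ht hs.le, mul_nonneg (mul_nonneg ht hs.le) hs.le, sq_nonneg t,
    mul_nonneg hs.le (sq_nonneg t), pow_pos hs 3]

/-- A positive element below `star g * g` is of the form `star z * z` with `z` in the closed right
ideal generated by `g`, and with `z` close to `g` if the square roots are close. -/
theorem exists_star_mul_self_eq {g c : A} (hc : 0 ≤ c) (h : c ≤ star g * g) :
    ∃ z : A, star z * z = c ∧ z ∈ closure (Set.range (g * ·)) ∧
      ‖z - g‖ ≤ ‖CFC.sqrt c - CFC.sqrt (star g * g)‖ := by
  set y := star g * g with hydef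
  have hy : 0 ≤ y := star_mul_self_nonneg g
  have hsc : star (CFC.sqrt c) = CFC.sqrt c := (CFC.sqrt_nonneg _).isSelfAdjoint.star_eq
  have hsy : star (CFC.sqrt y) = CFC.sqrt y := (CFC.sqrt_nonneg _).isSelfAdjoint.star_eq
  let s : ℕ → ℝ := fun n => 1 / ((n : ℝ) + 1)
  have hs (n : ℕ) : 0 < s n := Nat.one_div_pos_of_nat
  have hs0 : Tendsto s atTop (𝓝 0) := tendsto_one_div_add_atTop_nhds_zero_nat
  have hden (n : ℕ) (t : ℝ) : |t| + s n ≠ 0 := (add_pos_of_nonneg_of_pos (abs_nonneg t) (hs n)).ne'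
  -- With `|g| = √y`, the element sought is `g |g|⁻¹ √c`. Here `ff n` is a regularization of `t ↦
  -- t^(-1/2)` that vanishes at `0`, and `kf n = √t · ff n` gives an almost unit for `y`. The
  -- absolute values only make both continuous on all of `ℝ`.
  let kf : ℕ → ℝ → ℝ := fun n t => |t| / (|t| + s n)
  let ff : ℕ → ℝ → ℝ := fun n t => √|t| / (|t| + s n)
  have hkc (n : ℕ) : Continuous (kf n) := by
    exact continuous_abs.div (by fun_prop) (hden n)
  have hfc (n : ℕ) : Continuous (ff n) := by
    exact (continuous_abs.sqrt).div (by fun_prop) (hden n)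
  have hk0 (n : ℕ) : kf n 0 = 0 := by simp [kf]
  have hf0 (n : ℕ) : ff n 0 = 0 := by simp [ff]
  let k : ℕ → A := fun n => cfcₙ (kf n) y
  let f : ℕ → A := fun n => cfcₙ (ff n) y
  have hk_sa (n : ℕ) : IsSelfAdjoint (k n) := cfcₙ_predicate _ _
  have hsqrt : CFC.sqrt y = cfcₙ Real.sqrt y := CFC.sqrt_eq_real_sqrt y
  have hkf (n : ℕ) : CFC.sqrt y * f n = k n := by
    have hc1 := (hfc n).continuousOn (s := quasispectrum ℝ y)
    rw [hsqrt, ← cfcₙ_mul Real.sqrt (ff n) y (hg0 := hf0 n)]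
    refine cfcₙ_congr fun t ht => ?_
    have ht0 : 0 ≤ t := quasispectrum_nonneg_of_nonneg y hy t ht
    simp only [ff, kf, abs_of_nonneg ht0]
    rw [← mul_div_assoc, Real.mul_self_sqrt ht0]
  have hfk (n : ℕ) : f n * CFC.sqrt y = k n := by
    rw [← hkf, hsqrt]
    exact (cfcₙ_commute_cfcₙ _ _ _)
  have hk1 (n : ℕ) : ‖k n‖ ≤ 1 := by
    refine norm_cfcₙ_le fun t ht => ?_
    have ht0 : 0 ≤ t := quasispectrum_nonneg_of_nonneg y hy t ht
    have := hs n
    simp only [kf, abs_of_nonneg ht0, Real.norm_eq_abs]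
    rw [abs_of_nonneg (by positivity)]
    exact div_le_one_of_le₀ (by linarith) (by positivity)
  have hE (n : ℕ) : ‖y - k n * y - y * k n + k n * y * k n‖ ≤ s n := by
    refine norm_sub_cfcₙ_conjugate_le hy (hkc n).continuousOn (hk0 n) fun t ht0 => ?_
    exact abs_mul_one_sub_div_sq_le ht0 (hs n)
  have hkc_tendsto : Tendsto (fun n => k n * CFC.sqrt c) atTop (𝓝 (CFC.sqrt c)) := by
    rw [tendsto_iff_norm_sub_tendsto_zero]
    refine squeeze_zero (fun _ => norm_nonneg _) (fun n => ?_) (by simpa using hs0.sqrt)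
    rw [norm_sub_rev]
    exact Real.le_sqrt_of_sq_le ((norm_sqrt_sub_mul_sqrt_sq_le hc h (hk_sa n)).trans (hE n))
  have hgf (n : ℕ) (w : A) : ‖g * (f n * w)‖ = ‖k n * w‖ := by
    rw [norm_mul_eq_norm_sqrt_mul, ← mul_assoc, hkf]
  let z : ℕ → A := fun n => g * (f n * CFC.sqrt c)
  -- Left multiplication by `g` and by `√y` give equal norms, so differences of `z n` are as small
  -- as those of the convergent sequence `k n * √c`.
  have hzc : CauchySeq z := by
    have hcs := hkc_tendsto.cauchySeq
    rw [Metric.cauchySeq_iff] at hcs ⊢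
    intro ε hε
    obtain ⟨N, hN⟩ := hcs ε hε
    refine ⟨N, fun m hm n hn => ?_⟩
    convert hN m hm n hn using 1
    rw [dist_eq_norm, dist_eq_norm, ← mul_sub, ← sub_mul, norm_mul_eq_norm_sqrt_mul, ← mul_assoc,
      mul_sub, hkf, hkf, sub_mul]
  obtain ⟨z₀, hz₀⟩ := cauchySeq_tendsto_of_complete hzc
  refine ⟨z₀, ?_, ?_, ?_⟩
  · have h1 : Tendsto (fun n => star (z n) * z n) atTop (𝓝 (star z₀ * z₀)) := hz₀.star.mul hz₀
    have h2 : Tendsto (fun n => star (k n * CFC.sqrt c) * (k n * CFC.sqrt c)) atTop (𝓝 c) := by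
      have := hkc_tendsto.star.mul hkc_tendsto
      rwa [hsc, CFC.sqrt_mul_sqrt_self c hc] at this
    refine tendsto_nhds_unique (h1.congr fun n => ?_) h2
    have h3 : k n * CFC.sqrt c = CFC.sqrt y * (f n * CFC.sqrt c) := by rw [← mul_assoc, hkf]
    rw [h3]
    simp only [z]
    rw [star_mul, star_mul (CFC.sqrt y), hsy, mul_assoc, mul_assoc, ← mul_assoc (CFC.sqrt y) (CFC.sqrt y),
      CFC.sqrt_mul_sqrt_self y hy, hydef, mul_assoc]
  · exact mem_closure_of_tendsto hz₀ (Eventually.of_forall fun n => ⟨_, rfl⟩)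
  · have h1 (n : ℕ) : ‖z n - g‖ ≤ ‖CFC.sqrt c - CFC.sqrt y‖ + √(s n) := by
      have h2 : z n - g = g * (f n * (CFC.sqrt c - CFC.sqrt y)) + (g * k n - g) := by
        simp only [z]
        rw [mul_sub, hfk, mul_sub]; abel
      rw [h2]
      refine (norm_add_le _ _).trans (add_le_add ?_ ?_)
      · rw [hgf]
        refine (norm_mul_le _ _).trans ?_
        exact mul_le_of_le_one_left (norm_nonneg _) (hk1 n)
      · refine Real.le_sqrt_of_sq_le ?_
        rw [sq, ← CStarRing.norm_star_mul_self]
        convert hE n using 2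
        rw [star_sub, star_mul, (hk_sa n).star_eq]
        simp only [sub_mul, mul_sub, hydef, mul_assoc]
        abel
    have h3 : Tendsto (fun n => ‖CFC.sqrt c - CFC.sqrt y‖ + √(s n)) atTop
        (𝓝 (‖CFC.sqrt c - CFC.sqrt y‖ + 0)) := by
      simpa using (tendsto_const_nhds (x := ‖CFC.sqrt c - CFC.sqrt y‖)).add hs0.sqrt
    rw [add_zero] at h3
    exact le_of_tendsto_of_tendsto' (hz₀.sub_const g).norm h3 h1

theorem cfcₙ_conjugate_sq_sub {A : Type*} [NonUnitalCStarAlgebra A] {a : A} (ha : IsSelfAdjoint a)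
    {f : ℝ → ℝ} (hf : Continuous f) (hf0 : f 0 = 0) (r : ℝ) :
    cfcₙ (fun t => f t * t * (t * f t) - r * (f t * f t)) a =
      cfcₙ f a * (a * a) * cfcₙ f a - r • (cfcₙ f a * cfcₙ f a) := by
  rw [cfcₙ_sub (fun t => f t * t * (t * f t)) (fun t => r * (f t * f t)) a,
    cfcₙ_const_mul r (fun t => f t * f t) a, cfcₙ_mul f f a,
    cfcₙ_mul (fun t => f t * t) (fun t => t * f t) a, cfcₙ_mul f (fun t => t) a,
    cfcₙ_mul (fun t => t) f a, cfcₙ_id' ℝ a]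
  simp only [mul_assoc]

/-- Here `e` is a truncated inverse of `a`, arranged so that `p = a e` is an almost unit for `a`
with `‖e‖ ≤ 1 / γ`. Subtracting `γ ^ 4 / 2` times `e * e` leaves room for replacing `a * a` by a
nearby element without losing domination of `c`. Positivity of `c` survives because `e` lives on `t
≥ γ`, where `t² ≥ γ² ≥ γ⁴`. -/
theorem exists_cutoff {a : A} (ha : 0 ≤ a) {γ : ℝ} (hγ : 0 < γ) (hγ1 : γ ≤ 1) :
    ∃ e p c : A, IsSelfAdjoint e ∧ IsSelfAdjoint p ∧ p = a * e ∧ a * e = e * a ∧ ‖e‖ ≤ 1 / γ ∧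
      ‖p‖ ≤ 1 ∧ c = e * (a * a) * e - (γ ^ 4 / 2) • (e * e) ∧ 0 ≤ c ∧
      (∀ b, Commute b a → Commute b c) ∧ ‖a - p * a - a * p + p * a * p‖ ≤ γ := by
  have hsa : IsSelfAdjoint a := ha.isSelfAdjoint
  have hmax (t : ℝ) : 0 < max t γ := lt_max_of_lt_right hγ
  let ef : ℝ → ℝ := fun t => max (t - γ) 0 / (max t γ) ^ 2
  let pf : ℝ → ℝ := fun t => max (t - γ) 0 / max t γ
  let cf : ℝ → ℝ := fun t => ef t * t * (t * ef t) - γ ^ 4 / 2 * (ef t * ef t)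
  have hec : Continuous ef :=
    Continuous.div (by fun_prop) (by fun_prop) fun t => (pow_pos (hmax t) 2).ne'
  have hpc : Continuous pf := Continuous.div (by fun_prop) (by fun_prop) fun t => (hmax t).ne'
  have he0 : ef 0 = 0 := by simp [ef, hγ.le]
  have hp0 : pf 0 = 0 := by simp [pf, hγ.le]
  have hlow {t : ℝ} (ht : t ≤ γ) : ef t = 0 ∧ pf t = 0 := by
    simp [ef, pf, ht]
  have hhigh {t : ℝ} (ht : γ ≤ t) : ef t = (t - γ) / t ^ 2 ∧ pf t = (t - γ) / t := by
    simp [ef, pf, ht]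
  let e : A := cfcₙ ef a
  let p : A := cfcₙ pf a
  have he_sa : IsSelfAdjoint e := cfcₙ_predicate _ _
  have hp_sa : IsSelfAdjoint p := cfcₙ_predicate _ _
  have hp_eq : p = a * e := by
    conv_rhs => rw [← cfcₙ_id' ℝ a]
    simp only [p, e]
    rw [← cfcₙ_mul (fun t => t) ef a]
    refine cfcₙ_congr fun t _ => ?_
    rcases le_total t γ with h1 | h1
    · simp [hlow h1]
    · have : t ≠ 0 := (hγ.trans_le h1).ne'
      simp only [hhigh h1]
      field_simp
  have hae : a * e = e * a := by
    conv_lhs => rw [← cfcₙ_id' ℝ a]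
    conv_rhs => rw [← cfcₙ_id' ℝ a]
    exact cfcₙ_commute_cfcₙ _ _ _
  have he_norm : ‖e‖ ≤ 1 / γ := by
    refine norm_cfcₙ_le fun t _ => ?_
    rw [Real.norm_eq_abs]
    rcases le_total t γ with h1 | h1
    · simp [(hlow h1).1, hγ.le]
    · have h0 : 0 < t := hγ.trans_le h1
      rw [(hhigh h1).1, abs_of_nonneg (div_nonneg (by linarith) (by positivity)),
        div_le_div_iff₀ (by positivity) hγ]
      nlinarith
  have hp_norm : ‖p‖ ≤ 1 := by
    refine norm_cfcₙ_le fun t _ => ?_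
    rw [Real.norm_eq_abs]
    rcases le_total t γ with h1 | h1
    · simp [(hlow h1).2]
    · have h0 : 0 < t := hγ.trans_le h1
      rw [(hhigh h1).2, abs_of_nonneg (div_nonneg (by linarith) (by positivity)),
        div_le_one h0]
      linarith
  let c : A := cfcₙ cf a
  have hc_eq : c = e * (a * a) * e - (γ ^ 4 / 2) • (e * e) := by
    exact cfcₙ_conjugate_sq_sub hsa hec he0 _
  have hc_nonneg : 0 ≤ c := by
    refine cfcₙ_nonneg fun t _ => ?_
    rcases le_total t γ with h1 | h1
    · simp [cf, hlow h1]
    · have h2 : cf t = ef t ^ 2 * (t ^ 2 - γ ^ 4 / 2) := by simp only [cf]; ring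
      rw [h2]
      have h3 : γ ^ 4 ≤ γ ^ 2 := pow_le_pow_of_le_one hγ.le hγ1 (by norm_num)
      have h4 : γ ^ 2 ≤ t ^ 2 := pow_le_pow_left₀ hγ.le h1 2
      exact mul_nonneg (sq_nonneg _) (by nlinarith [pow_pos hγ 4])
  refine ⟨e, p, c, he_sa, hp_sa, hp_eq, hae, he_norm, hp_norm, hc_eq, hc_nonneg,
    fun b hb => (hsa.commute_cfcₙ hb.symm _).symm, ?_⟩
  · refine norm_sub_cfcₙ_conjugate_le ha hpc.continuousOn hp0 fun t ht0 => ?_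
    rcases le_total t γ with h1 | h1
    · simpa [(hlow h1).2, abs_of_nonneg ht0] using h1
    · have h0 : 0 < t := hγ.trans_le h1
      rw [(hhigh h1).2]
      have h2 : t * (1 - (t - γ) / t) ^ 2 = γ ^ 2 / t := by field_simp; ring
      rw [h2, abs_of_nonneg (by positivity), div_le_iff₀ h0]
      nlinarith


/-- If `h` almost acts as a unit on `a`, then some `z` in the closed right ideal of `h` is close to
an almost unit `p` for `a`, while `star z * z` is a function of `a`. -/
theorem exists_twist {a h : A} (ha : 0 ≤ a) (ha1 : ‖a‖ ≤ 1) (hh : IsSelfAdjoint h) (hh1 : ‖h‖ ≤ 1)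
    {γ : ℝ} (hγ : 0 < γ) (hγ1 : γ ≤ 1) (hah : ‖a - h * a‖ ≤ γ ^ 4 / 4) :
    ∃ z p : A, z ∈ closure (Set.range (h * ·)) ∧ (∀ b, Commute b a → Commute b (star z * z)) ∧
      IsSelfAdjoint p ∧ ‖p‖ ≤ 1 ∧ ‖z - p‖ ≤ 2 * γ ∧ ‖a - p * a - a * p + p * a * p‖ ≤ γ := by
  have hsa : IsSelfAdjoint a := ha.isSelfAdjoint
  obtain ⟨e, p, c, he_sa, hp_sa, hp_eq, hae, he_norm, hp_norm, hc_eq, hc_nonneg, hc_comm, hpa⟩ :=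
    exists_cutoff ha hγ hγ1
  -- `g` has the right range but `star g * g` is not a function of `a`. It is close to, and
  -- dominates, `c`, which is one; `exists_star_mul_self_eq` then corrects `g` to `z`.
  let g : A := h * p
  have hg_eq : star g * g = e * (a * h * (h * a)) * e := by
    simp only [g]
    rw [star_mul, hp_sa.star_eq, hh.star_eq]
    conv_lhs => rw [hp_eq]
    conv_lhs => enter [1, 1]; rw [hae]
    simp only [mul_assoc]
  let d : A := a * a - a * h * (h * a)
  have hd_sa : IsSelfAdjoint d := by
    simp only [d, IsSelfAdjoint, star_sub, star_mul, hsa.star_eq, hh.star_eq, mul_assoc]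
  have hha : ‖a * h‖ ≤ 1 := (norm_mul_le _ _).trans (mul_le_one₀ ha1 (norm_nonneg _) hh1)
  have hd_norm : ‖d‖ ≤ γ ^ 4 / 2 := by
    have h1 : d = star (a - h * a) * a + a * h * (a - h * a) := by
      simp only [d, star_sub, star_mul, hsa.star_eq, hh.star_eq, sub_mul, mul_sub]
      abel
    rw [h1]
    have h2 := norm_mul_le (star (a - h * a)) a
    have h3 := norm_mul_le (a * h) (a - h * a)
    rw [norm_star] at h2
    refine (norm_add_le _ _).trans ?_
    nlinarith [norm_nonneg (a - h * a)]
  have hcg : star g * g - c = (γ ^ 4 / 2) • (e * e) - e * d * e := by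
    rw [hg_eq, hc_eq]
    simp only [d, mul_sub, sub_mul]
    abel
  have hee : 0 ≤ e * e := by
    conv_rhs => enter [1]; rw [← he_sa.star_eq]
    exact star_mul_self_nonneg e
  -- `e d e ≤ ‖d‖ e²` and `‖d‖ ≤ γ ^ 4 / 2`: the error is absorbed by the margin built into `c`.
  have hc_le : c ≤ star g * g := by
    rw [← sub_nonneg, hcg, sub_nonneg]
    have h1 := CStarAlgebra.star_left_conjugate_le_norm_smul (a := e) (b := d) hd_sa
    rw [he_sa.star_eq] at h1
    exact h1.trans (smul_le_smul_of_nonneg_right hd_norm hee)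
  have hee_norm : ‖e * e‖ ≤ 1 / γ ^ 2 := by
    refine (norm_mul_le _ _).trans ?_
    calc ‖e‖ * ‖e‖ ≤ (1 / γ) * (1 / γ) := by gcongr
      _ = _ := by field_simp
  have hc_norm : ‖c - star g * g‖ ≤ γ ^ 2 := by
    rw [norm_sub_rev, hcg]
    have h1 : ‖(γ ^ 4 / 2) • (e * e)‖ ≤ γ ^ 2 / 2 := by
      rw [norm_smul, Real.norm_of_nonneg (by positivity)]
      calc γ ^ 4 / 2 * ‖e * e‖ ≤ γ ^ 4 / 2 * (1 / γ ^ 2) := by gcongr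
        _ = _ := by field_simp
    have h2 : ‖e * d * e‖ ≤ γ ^ 2 / 2 := by
      calc ‖e * d * e‖ ≤ ‖e‖ * ‖d‖ * ‖e‖ :=
            (norm_mul_le _ _).trans (by gcongr; exact norm_mul_le _ _)
        _ ≤ (1 / γ) * (γ ^ 4 / 2) * (1 / γ) := by gcongr
        _ = _ := by field_simp
    exact (norm_sub_le _ _).trans (by linarith)
  obtain ⟨z, hz1, hz2, hz3⟩ := exists_star_mul_self_eq hc_nonneg hc_le
  refine ⟨z, p, ?_, ?_, hp_sa, hp_norm, ?_, hpa⟩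
  · refine closure_mono ?_ hz2
    rintro _ ⟨w, rfl⟩
    exact ⟨p * w, by simp [g, mul_assoc]⟩
  · intro b hb
    rw [hz1]
    exact hc_comm b hb
  · have h1 : ‖z - g‖ ≤ γ := hz3.trans
      (norm_sqrt_sub_sqrt_le hc_nonneg (star_mul_self_nonneg g) hγ.le hc_norm)
    have h2 : ‖g - p‖ ≤ γ := by
      have h3 : g - p = -((a - h * a) * e) := by
        simp only [g]; rw [hp_eq, sub_mul, mul_assoc]; abel
      rw [h3, norm_neg]
      calc ‖(a - h * a) * e‖ ≤ (γ ^ 4 / 4) * (1 / γ) := (norm_mul_le _ _).trans (by gcongr)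
        _ = γ * (γ ^ 2 / 4) := by field_simp
        _ ≤ γ * 1 := by gcongr; nlinarith
        _ = γ := mul_one γ
    calc ‖z - p‖ = ‖(z - g) + (g - p)‖ := by abel_nf
      _ ≤ _ := (norm_add_le _ _).trans (by linarith)

end Generalities

/-! ### Minimal projections and strict order zero -/

section MinimalProjections

variable {F : Type*} [NonUnitalCStarAlgebra F]

/-- A projection in finite dimensions is a sum of minimal ones below it. The induction is on the
dimension of the right ideal `qF`: if `q` is not minimal it splits as `f + (q - f)`, and both pieces
generate strictly smaller right ideals. -/
theorem IsStarProjection.induction_minimal [FiniteDimensional ℂ F] {P : F → Prop} (h0 : P 0)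
    (hadd : ∀ x y, P x → P y → P (x + y)) {q : F} (hq : IsStarProjection q)
    (hmin : ∀ e, IsMinimalProjection e → q * e = e → P e) : P q := by
  induction hn : Module.finrank ℂ (LinearMap.range (LinearMap.mulLeft ℂ q)) using
    Nat.strong_induction_on generalizing q with
  | _ n ih =>
  subst hn
  by_cases hq0 : q = 0
  · rwa [hq0]
  by_cases hqm : IsMinimalProjection q
  · exact hmin q hqm hq.isIdempotentElem
  simp only [IsMinimalProjection, not_and, not_forall, not_or] at hqm
  obtain ⟨f, hf, hqf, hf0, hfq⟩ := hqm hq hq0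
  have hfq' : f * q = f := by
    have := congrArg star hqf
    rwa [star_mul, hf.isSelfAdjoint.star_eq, hq.isSelfAdjoint.star_eq] at this
  have hqq : q * q = q := hq.isIdempotentElem
  have hff : f * f = f := hf.isIdempotentElem
  have hd : IsStarProjection (q - f) := by
    refine ⟨?_, hq.isSelfAdjoint.sub hf.isSelfAdjoint⟩
    simp only [IsIdempotentElem, mul_sub, sub_mul, hqq, hff, hqf, hfq']
    abel
  have hrank (p : F) (hp : q * p = p) (hpq : p * q = p) (hpp : p * p = p) (hne : p ≠ q) :
      Module.finrank ℂ (LinearMap.range (LinearMap.mulLeft ℂ p)) <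
        Module.finrank ℂ (LinearMap.range (LinearMap.mulLeft ℂ q)) := by
    refine Submodule.finrank_lt_finrank_of_lt (lt_of_le_of_ne ?_ fun h => hne ?_)
    · rintro _ ⟨x, rfl⟩
      exact ⟨p * x, by simp [← mul_assoc, hp]⟩
    · have : q ∈ LinearMap.range (LinearMap.mulLeft ℂ p) := by
        rw [h]; exact ⟨q, by simpa using hqq⟩
      obtain ⟨x, hx⟩ := this
      simp only [LinearMap.mulLeft_apply] at hx
      rw [← hpq, ← hx, ← mul_assoc, hpp]
  have h1 : P f := ih _ (hrank f hqf hfq' hff hfq) hf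
    (fun e he hfe => hmin e he (by rw [← hfe, ← mul_assoc, hqf])) rfl
  have h2 : P (q - f) := by
    refine ih _ (hrank (q - f) ?_ ?_ hd.isIdempotentElem ?_) hd (fun e he hfe => hmin e he ?_) rfl
    · rw [mul_sub, hqq, hqf]
    · rw [sub_mul, hqq, hfq']
    · simpa using hf0
    · rw [← hfe, ← mul_assoc, mul_sub, hqq, hqf]
  simpa using hadd _ _ h1 h2

variable {A : Type*} [NonUnitalCStarAlgebra A]

theorem strictOrderLE_zero_iff {φ : F → A} (hφ : ∀ x, IsSelfAdjoint x → IsSelfAdjoint (φ x)) :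
    StrictOrderLE 0 φ ↔ ∀ e f, IsMinimalProjection e → IsMinimalProjection f → e * f = 0 →
      φ e * φ f = 0 := by
  have hswap {e f : F} (he : IsMinimalProjection e) (hf : IsMinimalProjection f)
      (h : φ e * φ f = 0) : φ f * φ e = 0 := by
    have := congrArg star h
    rwa [star_mul, star_zero, (hφ e he.1.isSelfAdjoint).star_eq,
      (hφ f hf.1.isSelfAdjoint).star_eq] at this
  constructor
  · intro h e f he hf hef
    have hfe : f * e = 0 := by
      have := congrArg star hef
      rwa [star_mul, star_zero, he.1.isSelfAdjoint.star_eq, hf.1.isSelfAdjoint.star_eq] at this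
    obtain ⟨i, j, hij, h⟩ := h ![e, f] (by intro i; fin_cases i <;> assumption)
      (by intro i j hij; fin_cases i <;> fin_cases j <;> simp_all)
    fin_cases i <;> fin_cases j <;> simp_all
  · intro h e he hef
    exact ⟨0, 1, by simp, h _ _ (he 0) (he 1) (hef 0 1 (by simp))⟩

/-- `u - e` is a sum of minimal projections orthogonal to `e`, so `φ e` annihilates `φ (u - e)` on
both sides, and both products with `φ u` equal `φ e * φ e`. -/
theorem commute_map_unit_of_strictOrderZero [FiniteDimensional ℂ F] {φ : F →ₗ[ℂ] A}
    (hφ : ∀ x, IsSelfAdjoint x → IsSelfAdjoint (φ x)) (h : StrictOrderLE 0 φ) {u : F}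
    (hu : ∀ x, u * x = x) (husa : IsSelfAdjoint u) {e : F} (he : IsMinimalProjection e) :
    Commute (φ e) (φ u) := by
  rw [strictOrderLE_zero_iff hφ] at h
  have hee : e * e = e := he.1.isIdempotentElem
  have heu : e * u = e := by
    have := congrArg star (hu e)
    rwa [star_mul, he.1.isSelfAdjoint.star_eq, husa.star_eq] at this
  have hd : IsStarProjection (u - e) := by
    refine ⟨?_, husa.sub he.1.isSelfAdjoint⟩
    simp only [IsIdempotentElem, mul_sub, sub_mul, hu, hee, heu]
    abel
  have h1 : φ e * φ (u - e) = 0 := by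
    refine IsStarProjection.induction_minimal (P := fun x => φ e * φ x = 0) (by simp)
      (fun x y hx hy => by simp [mul_add, hx, hy]) hd fun f hf hef => h e f he hf ?_
    rw [← hef, ← mul_assoc, mul_sub, heu, hee, sub_self, zero_mul]
  have h2 : φ (u - e) * φ e = 0 := by
    have := congrArg star h1
    rwa [star_mul, star_zero, (hφ e he.1.isSelfAdjoint).star_eq,
      (hφ _ hd.isSelfAdjoint).star_eq] at this
  have hu' : φ u = φ e + φ (u - e) := by rw [← map_add]; congr 1; abel
  rw [Commute, SemiconjBy, hu', mul_add, add_mul, h1, h2]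

/-- Minimal projections are preserved by injective homomorphisms with hereditary image. -/
theorem IsMinimalProjection.map {G : Type*} [NonUnitalCStarAlgebra G] (ι : F →⋆ₙₐ[ℂ] G)
    (hι : Function.Injective ι) (hher : ∀ (x : F) (y : G), ι x * y * ι x ∈ Set.range ι) {e : F}
    (he : IsMinimalProjection e) : IsMinimalProjection (ι e) := by
  refine ⟨he.1.map ι, fun h => he.2.1 (hι (by rw [h, map_zero])), fun f hf hef => ?_⟩
  have hfe : f * ι e = f := by
    have := congrArg star hef
    rwa [star_mul, hf.isSelfAdjoint.star_eq, (he.1.map ι).isSelfAdjoint.star_eq] at this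
  -- A subprojection of `ι e` equals its own compression by `ι e`, hence already comes from `F`.
  obtain ⟨f', hf'⟩ := hher e f
  rw [hef, hfe] at hf'
  have hf'p : IsStarProjection f' := by
    refine ⟨hι ?_, hι ?_⟩
    · rw [map_mul, hf', hf.isIdempotentElem]
    · rw [map_star, hf', hf.isSelfAdjoint.star_eq]
  rcases he.2.2 f' hf'p (hι (by rw [map_mul, hf', hef])) with h | h
  · left; rw [← hf', h, map_zero]
  · right; rw [← hf', h]

end MinimalProjections

/-! ### Closure properties of completely positive maps -/

section CompletelyPositive

variable {C D E : Type*} [NonUnitalCStarAlgebra C] [PartialOrder C] [StarOrderedRing C]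
  [NonUnitalCStarAlgebra D] [PartialOrder D] [StarOrderedRing D]
  [NonUnitalCStarAlgebra E] [PartialOrder E] [StarOrderedRing E]

/-- Complete positivity of a linear map. -/
def IsCP (T : C →ₗ[ℂ] D) : Prop :=
  ∀ (k : ℕ) (M : CStarMatrix (Fin k) (Fin k) C), 0 ≤ M → 0 ≤ M.map T

/-- A completely positive linear map, bundled. -/
def IsCP.toCP {T : C →ₗ[ℂ] D} (hT : IsCP T) : C →CP D :=
  { T with map_cstarMatrix_nonneg' := hT }

theorem IsCP.toCP_apply {T : C →ₗ[ℂ] D} (hT : IsCP T) (x : C) : hT.toCP x = T x := rfl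

theorem isCP_coe (T : C →CP D) : IsCP (T : C →ₗ[ℂ] D) := T.map_cstarMatrix_nonneg'

theorem isCP_starHom (ι : C →⋆ₙₐ[ℂ] D) : IsCP (ι : C →ₗ[ℂ] D) :=
  CompletelyPositiveMapClass.map_cstarMatrix_nonneg' ι

theorem IsCP.nonneg {T : C →ₗ[ℂ] D} (hT : IsCP T) {x : C} (hx : 0 ≤ x) : 0 ≤ T x :=
  map_nonneg hT.toCP hx

theorem IsCP.mono {T : C →ₗ[ℂ] D} (hT : IsCP T) {x y : C} (h : x ≤ y) : T x ≤ T y := by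
  rw [← sub_nonneg, ← map_sub]
  exact hT.nonneg (sub_nonneg.2 h)

theorem IsCP.isSelfAdjoint {T : C →ₗ[ℂ] D} (hT : IsCP T) {x : C} (hx : IsSelfAdjoint x) :
    IsSelfAdjoint (T x) := by
  rw [← CFC.posPart_sub_negPart x hx, map_sub]
  exact (hT.nonneg (CFC.posPart_nonneg x)).isSelfAdjoint.sub
    (hT.nonneg (CFC.negPart_nonneg x)).isSelfAdjoint

theorem IsCP.comp {S : D →ₗ[ℂ] E} {T : C →ₗ[ℂ] D} (hS : IsCP S) (hT : IsCP T) :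
    IsCP (S ∘ₗ T) := fun k M hM => hS k _ (hT k M hM)

theorem IsCP.sum {ι : Type*} (s : Finset ι) {T : ι → C →ₗ[ℂ] D} (hT : ∀ i ∈ s, IsCP (T i)) :
    IsCP (∑ i ∈ s, T i) := by
  intro k M hM
  have h : M.map ⇑(∑ i ∈ s, T i) = ∑ i ∈ s, M.map (T i) := by
    classical
    induction s using Finset.induction_on with
    | empty => ext i j; simp [CStarMatrix.map_apply, CStarMatrix.zero_apply]
    | insert a s ha ih =>
      rw [Finset.sum_insert ha, Finset.sum_insert ha,
        ← ih fun i hi => hT i (Finset.mem_insert_of_mem hi)]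
      ext i j; simp [CStarMatrix.map_apply]
  rw [h]
  exact Finset.sum_nonneg fun i hi => hT i hi k M hM

theorem IsCP.smul {T : C →ₗ[ℂ] D} (hT : IsCP T) {r : ℝ} (hr : 0 ≤ r) :
    IsCP ((r : ℂ) • T) := by
  intro k M hM
  have h : M.map ⇑((r : ℂ) • T) = (r : ℂ) • M.map T := by
    ext i j; simp [CStarMatrix.map_apply]
  rw [h]
  exact smul_nonneg (by exact_mod_cast hr) (hT k M hM)

/-- Conjugation `x ↦ z * x * star z` as a linear map. -/
def conjLinear {C : Type*} [NonUnitalCStarAlgebra C] (z : C) : C →ₗ[ℂ] C :=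
  LinearMap.mulLeft ℂ z ∘ₗ LinearMap.mulRight ℂ (star z)

theorem conjLinear_apply {C : Type*} [NonUnitalCStarAlgebra C] (z x : C) :
    conjLinear z x = z * x * star z := by
  simp [conjLinear, mul_assoc]

theorem isCP_conjLinear (z : C) : IsCP (conjLinear z) := by
  intro k M hM
  let d : CStarMatrix (Fin k) (Fin k) C := CStarMatrix.ofMatrix (Matrix.diagonal fun _ => z)
  have h : M.map (conjLinear z) = d * M * star d := by
    ext i j
    rw [CStarMatrix.map_apply, conjLinear_apply]
    have h1 (M : CStarMatrix (Fin k) (Fin k) C) (i j : Fin k) : (d * M) i j = z * M i j :=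
      Matrix.diagonal_mul _ _ _ _
    have h2 : d * M * star d = star (d * star (d * M)) := by simp
    rw [h2, CStarMatrix.star_apply, h1, CStarMatrix.star_apply, h1]
    simp [mul_assoc]
  rw [h]
  exact star_right_conjugate_nonneg hM d

/-- The matrix amplifications of `ι` are again injective homomorphisms, so they reflect positivity.
-/
theorem IsCP.of_comp_injective (ι : D →⋆ₙₐ[ℂ] E) (hι : Function.Injective ι) {T : C →ₗ[ℂ] D}
    (h : IsCP ((ι : D →ₗ[ℂ] E) ∘ₗ T)) : IsCP T := by
  intro k M hM
  refine nonneg_of_map_nonneg (CStarMatrix.mapₙₐ ι) (fun x y hxy => ?_) (h k M hM)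
  ext i j
  exact hι (congrFun (congrFun hxy i) j)

end CompletelyPositive

/-! ### Corners of direct sums of matrix algebras -/

theorem exists_isometry_of_isHermitian_of_mul_self {m : ℕ} {p : Matrix (Fin m) (Fin m) ℂ}
    (hp : p.IsHermitian) (hpp : p * p = p) :
    ∃ (k : ℕ) (V : Matrix (Fin m) (Fin k) ℂ), Vᴴ * V = 1 ∧ V * Vᴴ = p := by
  classical
  obtain ⟨U, lam, hU, hU', hspec⟩ : ∃ (U : Matrix (Fin m) (Fin m) ℂ) (lam : Fin m → ℂ),
      Uᴴ * U = 1 ∧ U * Uᴴ = 1 ∧ p = U * Matrix.diagonal lam * Uᴴ :=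
    ⟨hp.eigenvectorUnitary, _, Unitary.coe_star_mul_self hp.eigenvectorUnitary,
      Unitary.coe_mul_star_self hp.eigenvectorUnitary, hp.spectral_theorem⟩
  have hdiag : Matrix.diagonal lam = Uᴴ * p * U := by
    rw [hspec]
    calc _ = (Uᴴ * U) * Matrix.diagonal lam * (Uᴴ * U) := by rw [hU, one_mul, mul_one]
      _ = _ := by simp only [Matrix.mul_assoc]
  have hev (i : Fin m) : lam i = 0 ∨ lam i = 1 := by
    have h1 : Matrix.diagonal lam * Matrix.diagonal lam = Matrix.diagonal lam := by
      rw [hdiag]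
      calc Uᴴ * p * U * (Uᴴ * p * U) = Uᴴ * p * (U * Uᴴ) * p * U := by
            simp only [Matrix.mul_assoc]
        _ = _ := by rw [hU', mul_one, Matrix.mul_assoc Uᴴ, hpp]
    rw [Matrix.diagonal_mul_diagonal] at h1
    have h2 : lam i * lam i = lam i := congrFun (Matrix.diagonal_injective h1) i
    have h4 : lam i * (lam i - 1) = 0 := by rw [mul_sub, h2, mul_one, sub_self]
    rcases mul_eq_zero.1 h4 with h | h
    · exact Or.inl h
    · exact Or.inr (sub_eq_zero.1 h)
  let S := {i : Fin m // lam i = 1}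
  let σ : Fin (Fintype.card S) ≃ S := (Fintype.equivFin S).symm
  refine ⟨Fintype.card S, U.submatrix id fun j => (σ j).1, ?_, ?_⟩
  · have h1 : (U.submatrix id fun j => (σ j).1)ᴴ * (U.submatrix id fun j => (σ j).1) =
        (Uᴴ * U).submatrix (fun j => (σ j).1) (fun j => (σ j).1) := by
      ext a b; simp [Matrix.mul_apply]
    rw [h1, hU]
    exact Matrix.submatrix_one _ (Subtype.val_injective.comp σ.injective)
  · ext a b
    rw [hspec]
    rw [Matrix.mul_apply, Matrix.mul_apply]
    simp only [Matrix.mul_diagonal, Matrix.submatrix_apply, Matrix.conjTranspose_apply, id]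
    rw [Equiv.sum_comp σ (fun i : S => U a i * star (U b i)),
      ← Finset.sum_subtype (p := fun i => lam i = 1) (Finset.univ.filter fun i => lam i = 1) (by simp)
        (fun i => U a i * star (U b i)), Finset.sum_filter]
    refine Finset.sum_congr rfl fun i _ => ?_
    rcases hev i with h | h <;> simp [h]

/-- The indicator of `[κ, ∞)` is continuous on a finite spectrum, so the continuous functional
calculus applies to it. -/
theorem exists_spectral_projection {A : Type*} [NonUnitalCStarAlgebra A] [PartialOrder A]
    [StarOrderedRing A] {h : A} (hh : 0 ≤ h) (hfin : (quasispectrum ℝ h).Finite)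
    {κ : ℝ} (hκ : 0 < κ) :
    ∃ p : A, IsStarProjection p ∧ κ • p ≤ h ∧ ‖h - p * h - h * p + p * h * p‖ ≤ κ := by
  have hsa : IsSelfAdjoint h := hh.isSelfAdjoint
  let χ : ℝ → ℝ := fun t => if κ ≤ t then 1 else 0
  have hχc : ContinuousOn χ (quasispectrum ℝ h) := hfin.continuousOn _
  have hχ0 : χ 0 = 0 := by simp [χ, hκ]
  refine ⟨cfcₙ χ h, ⟨?_, cfcₙ_predicate _ _⟩, ?_, ?_⟩
  · rw [IsIdempotentElem, ← cfcₙ_mul χ χ h]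
    congr 1; ext t; simp [χ]
  · conv_rhs => rw [← cfcₙ_id' ℝ h]
    rw [← cfcₙ_smul κ χ h]
    refine cfcₙ_mono fun t ht => ?_
    have ht0 : 0 ≤ t := quasispectrum_nonneg_of_nonneg h hh t ht
    by_cases h1 : κ ≤ t <;> simp [χ, h1, ht0]
  · refine norm_sub_cfcₙ_conjugate_le hh hχc hχ0 fun t ht0 => ?_
    by_cases h1 : κ ≤ t
    · simp [χ, h1, hκ.le]
    · simp [χ, h1, abs_of_nonneg ht0]; linarith

theorem finite_quasispectrum_cstarMatrix {m : ℕ} (h : CStarMatrix (Fin m) (Fin m) ℂ) :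
    (quasispectrum ℝ h).Finite := by
  have h1 : (spectrum ℂ h).Finite := by
    have := AlgEquiv.spectrum_eq
      (CStarMatrix.ofMatrixStarAlgEquiv (n := Fin m) (A := ℂ)).toAlgEquiv
      (CStarMatrix.ofMatrix.symm h)
    rw [show spectrum ℂ h = _ from this]
    exact Matrix.finite_spectrum _
  rw [quasispectrum_eq_spectrum_union_zero, ← spectrum.preimage_algebraMap ℂ]
  exact (h1.preimage (FaithfulSMul.algebraMap_injective ℝ ℂ).injOn).union (Set.finite_singleton 0)

section Blocks

variable {ι : Type} {r k : ι → ℕ}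

/-- The homomorphism `x ↦ V * x * V*` of `⨁ M_{k i}` into `⨁ M_{r i}` given by isometries `V i`. -/
def blockHom (V : ∀ i, Matrix (Fin (r i)) (Fin (k i)) ℂ) (hV : ∀ i, (V i)ᴴ * V i = 1) :
    MatrixSum k →⋆ₙₐ[ℂ] MatrixSum r where
  toFun x i := CStarMatrix.ofMatrix (V i * CStarMatrix.ofMatrix.symm (x i) * (V i)ᴴ)
  map_smul' c x := funext fun i =>
    have h (X : Matrix (Fin (k i)) (Fin (k i)) ℂ) :
        V i * (c • X) * (V i)ᴴ = c • (V i * X * (V i)ᴴ) := by simp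
    h (x i)
  map_zero' := funext fun i =>
    have h : V i * (0 : Matrix (Fin (k i)) (Fin (k i)) ℂ) * (V i)ᴴ = 0 := by simp
    h
  map_add' x y := funext fun i =>
    have h (X Y : Matrix (Fin (k i)) (Fin (k i)) ℂ) :
        V i * (X + Y) * (V i)ᴴ = V i * X * (V i)ᴴ + V i * Y * (V i)ᴴ := by
      rw [Matrix.mul_add, Matrix.add_mul]
    h (x i) (y i)
  map_mul' x y := funext fun i =>
    have h (X Y : Matrix (Fin (k i)) (Fin (k i)) ℂ) :
        V i * (X * Y) * (V i)ᴴ = (V i * X * (V i)ᴴ) * (V i * Y * (V i)ᴴ) := by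
      calc V i * (X * Y) * (V i)ᴴ =
            V i * X * (1 : Matrix (Fin (k i)) (Fin (k i)) ℂ) * Y * (V i)ᴴ := by
              simp [Matrix.mul_assoc]
        _ = _ := by rw [← hV i]; simp only [Matrix.mul_assoc]
    h (x i) (y i)
  map_star' x := funext fun i =>
    have h (X : Matrix (Fin (k i)) (Fin (k i)) ℂ) :
        V i * Xᴴ * (V i)ᴴ = (V i * X * (V i)ᴴ)ᴴ := by
      simp [Matrix.conjTranspose_mul, Matrix.mul_assoc]
    h (x i)

/-- The compression `x ↦ V* * x * V` of `⨁ M_{r i}` to `⨁ M_{k i}`. -/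
def compress (V : ∀ i, Matrix (Fin (r i)) (Fin (k i)) ℂ) : MatrixSum r →ₗ[ℂ] MatrixSum k where
  toFun x i := CStarMatrix.ofMatrix ((V i)ᴴ * CStarMatrix.ofMatrix.symm (x i) * V i)
  map_add' x y := funext fun i =>
    have h (X Y : Matrix (Fin (r i)) (Fin (r i)) ℂ) :
        (V i)ᴴ * (X + Y) * V i = (V i)ᴴ * X * V i + (V i)ᴴ * Y * V i := by
      rw [Matrix.mul_add, Matrix.add_mul]
    h (x i) (y i)
  map_smul' c x := funext fun i =>
    have h (X : Matrix (Fin (r i)) (Fin (r i)) ℂ) :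
        (V i)ᴴ * (c • X) * V i = c • ((V i)ᴴ * X * V i) := by simp
    h (x i)

variable (V : ∀ i, Matrix (Fin (r i)) (Fin (k i)) ℂ) (hV : ∀ i, (V i)ᴴ * V i = 1)

theorem compress_blockHom (x : MatrixSum k) : compress V (blockHom V hV x) = x :=
  funext fun i =>
    have h (X : Matrix (Fin (k i)) (Fin (k i)) ℂ) :
        (V i)ᴴ * (V i * X * (V i)ᴴ) * V i = X := by
      calc _ = ((V i)ᴴ * V i) * X * ((V i)ᴴ * V i) := by simp only [Matrix.mul_assoc]
        _ = X := by rw [hV i]; simp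
    h (x i)

theorem blockHom_injective : Function.Injective (blockHom V hV) :=
  Function.LeftInverse.injective (compress_blockHom V hV)

/-- The unit of `⨁ M_{k i}`. -/
def unit (k : ι → ℕ) : MatrixSum k := fun _ => 1

theorem unit_mul (x : MatrixSum k) : unit k * x = x := funext fun i => one_mul (x i)

theorem star_unit : star (unit k) = unit k := funext fun _ => star_one _

theorem blockHom_compress (x : MatrixSum r) :
    blockHom V hV (compress V x) = blockHom V hV (unit k) * x * blockHom V hV (unit k) :=
  funext fun i =>
    have h (X : Matrix (Fin (r i)) (Fin (r i)) ℂ) :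
        V i * ((V i)ᴴ * X * V i) * (V i)ᴴ =
          (V i * (1 : Matrix (Fin (k i)) (Fin (k i)) ℂ) * (V i)ᴴ) * X *
            (V i * (1 : Matrix (Fin (k i)) (Fin (k i)) ℂ) * (V i)ᴴ) := by
      simp [Matrix.mul_assoc]
    h (x i)

/-- The range is the full corner `pFp` with `p` the image of the unit; this is the heredity that
`IsMinimalProjection.map` needs. -/
theorem blockHom_mul_mul_mem_range (x : MatrixSum k) (y : MatrixSum r) :
    blockHom V hV x * y * blockHom V hV x ∈ Set.range (blockHom V hV) := by
  refine ⟨x * compress V y * x, ?_⟩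
  have hx : x * unit k = x := funext fun i => mul_one (x i)
  rw [map_mul, map_mul, blockHom_compress]
  calc _ = (blockHom V hV x * blockHom V hV (unit k)) * y *
        (blockHom V hV (unit k) * blockHom V hV x) := by simp only [mul_assoc]
    _ = _ := by rw [← map_mul, ← map_mul, hx, unit_mul]

theorem norm_unit_le [Fintype ι] : ‖unit k‖ ≤ 1 := by
  refine (pi_norm_le_iff_of_nonneg zero_le_one).2 fun i => ?_
  have h : ‖(1 : CStarMatrix (Fin (k i)) (Fin (k i)) ℂ)‖ * ‖(1 : CStarMatrix (Fin (k i)) (Fin (k i)) ℂ)‖ =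
      ‖(1 : CStarMatrix (Fin (k i)) (Fin (k i)) ℂ)‖ := by
    rw [← CStarRing.norm_star_mul_self, star_one, one_mul]
  show ‖(1 : CStarMatrix (Fin (k i)) (Fin (k i)) ℂ)‖ ≤ 1
  nlinarith

/-- A positive element of `⨁ M_{r i}` dominates, and is almost supported on, a corner. -/
theorem exists_corner {s : ℕ} {r : Fin s → ℕ} {h : MatrixSum r} (hh : 0 ≤ h) {κ : ℝ} (hκ : 0 < κ) :
    ∃ (k : Fin s → ℕ) (V : ∀ i, Matrix (Fin (r i)) (Fin (k i)) ℂ) (hV : ∀ i, (V i)ᴴ * V i = 1),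
      κ • blockHom V hV (unit k) ≤ h ∧
      ‖h - blockHom V hV (unit k) * h - h * blockHom V hV (unit k) +
        blockHom V hV (unit k) * h * blockHom V hV (unit k)‖ ≤ κ := by
  choose p hp hph hpn using fun i =>
    exists_spectral_projection (hh i) (finite_quasispectrum_cstarMatrix (h i)) hκ
  choose k V hV hVp using fun i => exists_isometry_of_isHermitian_of_mul_self
    (p := CStarMatrix.ofMatrix.symm (p i)) (hp i).isSelfAdjoint (hp i).isIdempotentElem
  have hpV : blockHom V hV (unit k) = p := funext fun i =>
    (congrArg (· * (V i)ᴴ) (Matrix.mul_one (V i))).trans (hVp i)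
  refine ⟨k, V, hV, ?_, ?_⟩
  · rw [hpV]
    exact fun i => hph i
  · rw [hpV]
    exact (pi_norm_le_iff_of_nonneg hκ.le).2 fun i => hpn i

end Blocks

theorem le_norm_smul_of_unit {F : Type*} [NonUnitalCStarAlgebra F] [PartialOrder F]
    [StarOrderedRing F] {u x : F} (hu : ∀ x, u * x = x) (husa : IsSelfAdjoint u)
    (hx : IsSelfAdjoint x) : x ≤ ‖x‖ • u := by
  have h := CStarAlgebra.star_left_conjugate_le_norm_smul (a := u) hx
  have hxu : x * u = x := by
    have := congrArg star (hu x)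
    rwa [star_mul, hx.star_eq, husa.star_eq] at this
  rwa [husa.star_eq, hu, hu, hxu] at h

theorem norm_conjugate_sub_le {A : Type*} [NonUnitalCStarAlgebra A] {q : A} (hq : ‖q‖ ≤ 1) (w : A) :
    ‖w - q * w - w * q + q * w * q‖ ≤ 4 * ‖w‖ := by
  have h1 : ‖q * w‖ ≤ ‖w‖ :=
    (norm_mul_le _ _).trans (mul_le_of_le_one_left (norm_nonneg _) hq)
  have h2 : ‖w * q‖ ≤ ‖w‖ :=
    (norm_mul_le _ _).trans (mul_le_of_le_one_right (norm_nonneg _) hq)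
  have h3 : ‖q * w * q‖ ≤ ‖w‖ :=
    (norm_mul_le _ _).trans ((mul_le_of_le_one_right (norm_nonneg _) hq).trans h1)
  calc _ ≤ ‖w‖ + ‖q * w‖ + ‖w * q‖ + ‖q * w * q‖ :=
        (norm_add_le _ _).trans (add_le_add_left ((norm_sub_le _ _).trans
          (add_le_add_left (norm_sub_le _ _) _)) _)
    _ ≤ _ := by linarith

theorem norm_le_of_nonneg_bound {C D : Type*} [NonUnitalCStarAlgebra C] [PartialOrder C]
    [StarOrderedRing C] [NonUnitalCStarAlgebra D] {T : C →ₗ[ℂ] D} {K : ℝ} (hK : 0 ≤ K)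
    (h : ∀ x, 0 ≤ x → ‖T x‖ ≤ K * ‖x‖) (x : C) : ‖T x‖ ≤ 4 * K * ‖x‖ := by
  obtain ⟨y, hy0, hy1, hy⟩ := CStarAlgebra.exists_sum_four_nonneg x
  conv_lhs => rw [hy]
  simp only [map_sum, map_smul]
  refine (norm_sum_le _ _).trans ?_
  calc ∑ i : Fin 4, ‖Complex.I ^ (i : ℕ) • T (y i)‖ ≤ ∑ _i : Fin 4, K * ‖x‖ := by
        refine Finset.sum_le_sum fun i _ => ?_
        rw [norm_smul, norm_pow, Complex.norm_I, one_pow, one_mul]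
        exact (h _ (hy0 i)).trans (by gcongr; exact hy1 i)
    _ = 4 * K * ‖x‖ := by simp; ring

/-! ### Conjugating one order zero map into a hereditary subalgebra -/

section Hereditary

variable {A B : Type*} [NonUnitalCStarAlgebra A] [PartialOrder A] [StarOrderedRing A]
  [NonUnitalCStarAlgebra B] [PartialOrder B] [StarOrderedRing B]

/-- For `w ≥ 0`, `h w h ≤ ‖w‖ h²` lies in the image by heredity. Linearity gives all `w`, and
closedness of the image gives the closure of the right ideal. -/
theorem conjugate_mem_range {A B : Type*} [NonUnitalCStarAlgebra A] [PartialOrder A]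
    [StarOrderedRing A] [NonUnitalCStarAlgebra B] {ι : B →⋆ₙₐ[ℂ] A} (hι : Function.Injective ι)
    (hher : ∀ a b, 0 ≤ a → a ≤ ι b → a ∈ Set.range ι) {h : B} (hh : IsSelfAdjoint h) {z : A}
    (hz : z ∈ closure (Set.range (ι h * ·))) (y : A) : z * y * star z ∈ Set.range ι := by
  have hclosed : IsClosed (Set.range ι) :=
    (NonUnitalStarAlgHom.isometry ι hι).isClosedEmbedding.isClosed_range
  have hpos (w : A) (hw : 0 ≤ w) : ι h * w * ι h ∈ Set.range ι := by
    refine hher _ (‖w‖ • (h * h)) ?_ ?_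
    · exact (hh.map ι).conjugate_nonneg hw
    · have := CStarAlgebra.star_left_conjugate_le_norm_smul (a := ι h) (IsSelfAdjoint.of_nonneg hw)
      rw [(hh.map ι).star_eq] at this
      convert this using 1
      rw [← Complex.coe_smul, ← Complex.coe_smul, map_smul, map_mul]
  have hall (w : A) : ι h * w * ι h ∈ Set.range ι := by
    obtain ⟨x, hx0, -, hx⟩ := CStarAlgebra.exists_sum_four_nonneg w
    choose b hb using fun i => hpos (x i) (hx0 i)
    refine ⟨∑ i : Fin 4, Complex.I ^ (i : ℕ) • b i, ?_⟩
    rw [hx, map_sum, Finset.mul_sum, Finset.sum_mul]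
    refine Finset.sum_congr rfl fun i _ => ?_
    rw [map_smul, hb, mul_smul_comm, smul_mul_assoc]
  have hcont : Continuous fun z : A => z * y * star z := by fun_prop
  refine closure_minimal ?_ (hclosed.preimage hcont) hz
  rintro _ ⟨m, rfl⟩
  have h1 : ι h * m * y * star (ι h * m) = ι h * (m * y * star m) * ι h := by
    rw [star_mul, (hh.map ι).star_eq]; simp only [mul_assoc]
  show ι h * m * y * star (ι h * m) ∈ Set.range ι
  rw [h1]
  exact hall _

/-- An order zero map whose unit is almost fixed by an element of a hereditary subalgebra can be
conjugated into this subalgebra, preserving order zero and changing the map only slightly. -/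
theorem exists_conjugate_into_hereditary {A B : Type*} [NonUnitalCStarAlgebra A] [PartialOrder A]
    [StarOrderedRing A] [NonUnitalCStarAlgebra B] {ι : B →⋆ₙₐ[ℂ] A} (hι : Function.Injective ι)
    (hher : ∀ a b, 0 ≤ a → a ≤ ι b → a ∈ Set.range ι) {h : B} (hh : IsSelfAdjoint h)
    (hh1 : ‖h‖ ≤ 1) {F : Type*} [NonUnitalCStarAlgebra F] [PartialOrder F] [StarOrderedRing F]
    [FiniteDimensional ℂ F] {u : F} (hu : ∀ x, u * x = x) (husa : IsSelfAdjoint u) (hu0 : 0 ≤ u)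
    (hu1 : ‖u‖ ≤ 1) {θ : F →ₗ[ℂ] A} (hθ : IsCP θ) (hθ1 : ∀ x, ‖θ x‖ ≤ ‖x‖)
    (hθ0 : StrictOrderLE 0 θ) {β : ℝ} (hβ : 0 < β) (hβ1 : β ≤ 1)
    (hhu : ‖θ u - ι h * θ u‖ ≤ β ^ 8 / 4) :
    ∃ z : A, (∀ y, z * y * star z ∈ Set.range ι) ∧ StrictOrderLE 0 (conjLinear z ∘ₗ θ) ∧
      ∀ x, 0 ≤ x → ‖conjLinear z (θ x) - θ x‖ ≤ 10 * β * ‖x‖ := by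
  have hh1' : ‖ι h‖ ≤ 1 := by rwa [NonUnitalStarAlgHom.norm_map ι hι]
  -- `exists_twist` is used with `γ = β ^ 2`, since `norm_sub_mul_sq_le` costs a square root; this
  -- is why the hypothesis has `β ^ 8 = γ ^ 4`.
  have hγ : 0 < β ^ 2 := by positivity
  have hγ1 : β ^ 2 ≤ 1 := pow_le_one₀ hβ.le hβ1
  obtain ⟨z, p, hz1, hz2, hp1, hp2, hzp, hpa⟩ := exists_twist (hθ.nonneg hu0)
    ((hθ1 u).trans hu1) (hh.map ι) hh1' hγ hγ1 (by convert hhu using 2; ring)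
  refine ⟨z, conjugate_mem_range hι hher hh hz1, ?_, fun x hx => ?_⟩
  · rw [strictOrderLE_zero_iff fun x hx => ((isCP_conjLinear z).comp hθ).isSelfAdjoint hx]
    intro e f he hf hef
    have h1 := (strictOrderLE_zero_iff fun x hx => hθ.isSelfAdjoint hx).1 hθ0 e f he hf hef
    have h2 := hz2 _ (commute_map_unit_of_strictOrderZero
      (fun x hx => hθ.isSelfAdjoint hx) hθ0 hu husa hf)
    simp only [LinearMap.comp_apply, conjLinear_apply]
    -- `star z * z` commutes with `θ f` because `θ f` commutes with `θ u`; moving it aside exposes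
    -- `θ e * θ f = 0`.
    calc z * θ e * star z * (z * θ f * star z) =
          z * θ e * ((star z * z) * θ f) * star z := by simp only [mul_assoc]
      _ = z * (θ e * θ f) * (star z * z) * star z := by
          rw [← h2.eq]; simp only [mul_assoc]
      _ = 0 := by rw [h1]; simp
  · rw [conjLinear_apply]
    set y := θ x with hy
    have hy0 : 0 ≤ y := hθ.nonneg hx
    have hyn : ‖y‖ ≤ ‖x‖ := hθ1 x
    have hxn : 0 ≤ ‖x‖ := norm_nonneg x
    have h1 : y ≤ ‖x‖ • θ u := by
      have h2 := hθ.mono (le_norm_smul_of_unit hu husa hx.isSelfAdjoint)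
      rwa [← Complex.coe_smul, map_smul, Complex.coe_smul] at h2
    have h2 : ‖y - p * y‖ ≤ β * ‖x‖ := by
      have h3 := norm_sub_mul_sq_le hy0 h1 hp1
      have h4 : ‖x‖ • θ u - p * ‖x‖ • θ u - ‖x‖ • θ u * p + p * ‖x‖ • θ u * p =
          ‖x‖ • (θ u - p * θ u - θ u * p + p * θ u * p) := by
        simp only [mul_smul_comm, smul_mul_assoc, smul_sub, smul_add]
      rw [h4, norm_smul, norm_norm] at h3
      refine (pow_le_pow_iff_left₀ (norm_nonneg _) (by positivity) two_ne_zero).1 (h3.trans ?_)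
      calc ‖y‖ * (‖x‖ * _) ≤ ‖x‖ * (‖x‖ * β ^ 2) := by gcongr
        _ = (β * ‖x‖) ^ 2 := by ring
    have h3 := norm_sub_mul_mul_le hy0.isSelfAdjoint hp1 hp2
    have hβ2 : β ^ 2 ≤ β := by nlinarith
    have hzn : ‖z‖ ≤ 3 := by
      calc ‖z‖ = ‖(z - p) + p‖ := by simp
        _ ≤ 2 * β ^ 2 + 1 := (norm_add_le _ _).trans (add_le_add hzp hp2)
        _ ≤ 3 := by linarith
    have h4 : z * y * star z - p * y * p = (z - p) * y * star z + p * y * star (z - p) := by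
      rw [star_sub, hp1.star_eq]; noncomm_ring
    have h5 : ‖(z - p) * y * star z‖ ≤ 2 * β ^ 2 * ‖x‖ * 3 := by
      refine (norm_mul_le _ _).trans ?_
      rw [norm_star]
      gcongr
      exact (norm_mul_le _ _).trans (by gcongr)
    have h6 : ‖p * y * star (z - p)‖ ≤ 1 * ‖x‖ * (2 * β ^ 2) := by
      refine (norm_mul_le _ _).trans ?_
      rw [norm_star]
      gcongr
      exact (norm_mul_le _ _).trans (by gcongr)
    calc ‖z * y * star z - y‖ = ‖((z - p) * y * star z + p * y * star (z - p)) - (y - p * y * p)‖ := by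
          rw [← h4]; congr 1; abel
      _ ≤ 2 * β ^ 2 * ‖x‖ * 3 + 1 * ‖x‖ * (2 * β ^ 2) + 2 * (β * ‖x‖) :=
          (norm_sub_le _ _).trans (add_le_add ((norm_add_le _ _).trans (add_le_add h5 h6))
            (h3.trans (by gcongr)))
      _ = (8 * β ^ 2 + 2 * β) * ‖x‖ := by ring
      _ ≤ 10 * β * ‖x‖ := by gcongr; linarith

theorem exists_almost_unit {h : B} (hh : 0 ≤ h) {s : ℝ} (hs : 0 < s) :
    ∃ k : B, IsSelfAdjoint k ∧ ‖k‖ ≤ 1 ∧ ‖h - k * h - h * k + k * h * k‖ ≤ s := by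
  have hc : Continuous fun t : ℝ => |t| / (|t| + s) :=
    continuous_abs.div (by fun_prop) fun t => (add_pos_of_nonneg_of_pos (abs_nonneg t) hs).ne'
  refine ⟨cfcₙ (fun t : ℝ => |t| / (|t| + s)) h, cfcₙ_predicate _ _, ?_, ?_⟩
  · refine norm_cfcₙ_le fun t _ => ?_
    rw [Real.norm_of_nonneg (by positivity)]
    exact div_le_one_of_le₀ (by linarith) (by positivity)
  · exact norm_sub_cfcₙ_conjugate_le hh hc.continuousOn (by simp) fun t ht =>
      abs_mul_one_sub_div_sq_le ht hs

end Hereditary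

/-! ### Splitting the summands by colour -/

section Colors

variable {s : ℕ} (r : Fin s → ℕ) (I : Set (Fin s))

/-- `extendByZero` as a homomorphism. -/
def extHom : MatrixSum (fun i : I => r i) →⋆ₙₐ[ℂ] MatrixSum r where
  toFun := extendByZero r I
  map_smul' c x := by
    funext i; by_cases h : i ∈ I <;> simp [extendByZero, h]
  map_zero' := by
    funext i; by_cases h : i ∈ I <;> simp [extendByZero, h]
  map_add' x y := by
    funext i; by_cases h : i ∈ I <;> simp [extendByZero, h]
  map_mul' x y := by
    funext i; by_cases h : i ∈ I <;> simp [extendByZero, h]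
  map_star' x := by
    funext i; by_cases h : i ∈ I <;> simp [extendByZero, h]

/-- Restriction to the summands in `I`. -/
def resHom : MatrixSum r →⋆ₙₐ[ℂ] MatrixSum (fun i : I => r i) where
  toFun x i := x i
  map_smul' _ _ := rfl
  map_zero' := rfl
  map_add' _ _ := rfl
  map_mul' _ _ := rfl
  map_star' _ := rfl

theorem extHom_apply_of_mem (x : MatrixSum (fun i : I => r i)) {i : Fin s} (h : i ∈ I) :
    extHom r I x i = x ⟨i, h⟩ := dif_pos h

theorem extHom_apply_of_notMem (x : MatrixSum (fun i : I => r i)) {i : Fin s} (h : i ∉ I) :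
    extHom r I x i = 0 := dif_neg h

theorem resHom_extHom (x : MatrixSum (fun i : I => r i)) : resHom r I (extHom r I x) = x :=
  funext fun i => extHom_apply_of_mem r I x i.2

theorem resHom_extHom_of_disjoint {J : Set (Fin s)} (h : Disjoint I J)
    (x : MatrixSum (fun i : I => r i)) : resHom r J (extHom r I x) = 0 :=
  funext fun i => extHom_apply_of_notMem r I x fun hi => Set.disjoint_left.1 h hi i.2

theorem extHom_injective : Function.Injective (extHom r I) :=
  Function.LeftInverse.injective (resHom_extHom r I)

theorem sum_extHom_resHom {n : ℕ} (c : Fin s → Fin n) (x : MatrixSum r) :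
    ∑ j, extHom r {i | c i = j} (resHom r {i | c i = j} x) = x := by
  funext i
  rw [Finset.sum_apply, Finset.sum_eq_single (c i)]
  · exact extHom_apply_of_mem r {i' | c i' = c i} _ rfl
  · intro j _ hj
    exact extHom_apply_of_notMem r {i' | c i' = j} _ fun h => hj (Eq.symm h)
  · simp

theorem blockHom_extHom {k : Fin s → ℕ} (V : ∀ i, Matrix (Fin (r i)) (Fin (k i)) ℂ)
    (hV : ∀ i, (V i)ᴴ * V i = 1) (x : MatrixSum (fun i : I => k i)) :
    blockHom V hV (extHom k I x) =
      extHom r I (blockHom (fun i : I => V i) (fun i => hV i) x) := by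
  funext i
  by_cases h : i ∈ I
  · rw [extHom_apply_of_mem r I _ h]
    show CStarMatrix.ofMatrix (V i * CStarMatrix.ofMatrix.symm (extHom k I x i) * (V i)ᴴ) = _
    rw [extHom_apply_of_mem k I _ h]
    rfl
  · rw [extHom_apply_of_notMem r I _ h]
    show CStarMatrix.ofMatrix (V i * CStarMatrix.ofMatrix.symm (extHom k I x i) * (V i)ᴴ) = _
    rw [extHom_apply_of_notMem k I _ h]
    have h0 : V i * (0 : Matrix (Fin (k i)) (Fin (k i)) ℂ) * (V i)ᴴ = 0 := by simp
    exact h0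

theorem finiteDimensional_matrixSum {ι : Type} [Finite ι] (r : ι → ℕ) :
    FiniteDimensional ℂ (MatrixSum r) := by
  have (i : ι) : FiniteDimensional ℂ (CStarMatrix (Fin (r i)) (Fin (r i)) ℂ) :=
    Module.Finite.equiv (CStarMatrix.ofMatrixₗ (R := ℂ) (m := Fin (r i)) (n := Fin (r i)) (A := ℂ))
  infer_instance

theorem unit_nonneg {ι : Type} [Fintype ι] (r : ι → ℕ) : 0 ≤ unit r := by
  have h := star_mul_self_nonneg (unit r)
  rwa [star_unit, unit_mul] at h

theorem extHom_unit_le : extHom r I (unit _) ≤ unit r := by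
  intro i
  by_cases h : i ∈ I
  · rw [extHom_apply_of_mem r I _ h]; rfl
  · rw [extHom_apply_of_notMem r I _ h]
    exact unit_nonneg r i

end Colors

/-! ### Assembling the colours into a decomposable contraction -/

section

variable {A B : Type*} [NonUnitalCStarAlgebra A] [PartialOrder A] [StarOrderedRing A]
  [NonUnitalCStarAlgebra B] [PartialOrder B] [StarOrderedRing B] {n s : ℕ} {r : Fin s → ℕ}

/-- Minimal projections of a corner are minimal in the whole algebra, and `blockHom` respects the
colouring. -/
theorem IsDecomposable.comp_blockHom {φ : MatrixSum r →ₗ[ℂ] A} (hφ : IsCP φ)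
    (h : IsDecomposable n φ) {k : Fin s → ℕ} (V : ∀ i, Matrix (Fin (r i)) (Fin (k i)) ℂ)
    (hV : ∀ i, (V i)ᴴ * V i = 1) : IsDecomposable n (φ ∘ blockHom V hV) := by
  obtain ⟨c, hc⟩ := h
  refine ⟨c, fun j => ?_⟩
  have h1 : ∀ x : MatrixSum (fun i : {i | c i = j} => r i), IsSelfAdjoint x →
      IsSelfAdjoint ((φ ∘ extendByZero r {i | c i = j}) x) := fun x hx =>
    hφ.isSelfAdjoint (hx.map (extHom r {i | c i = j}))
  have h2 : ∀ x : MatrixSum (fun i : {i | c i = j} => k i), IsSelfAdjoint x →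
      IsSelfAdjoint (((φ ∘ blockHom V hV) ∘ extendByZero k {i | c i = j}) x) := fun x hx =>
    hφ.isSelfAdjoint ((hx.map (extHom k {i | c i = j})).map (blockHom V hV))
  rw [strictOrderLE_zero_iff h2]
  intro e f he hf hef
  let jh := blockHom (fun i : {i | c i = j} => V i) (fun i => hV i)
  have hinj : Function.Injective jh := blockHom_injective _ _
  have h3 := (strictOrderLE_zero_iff h1).1 (hc j) _ _
    (he.map jh hinj (blockHom_mul_mul_mem_range _ _))
    (hf.map jh hinj (blockHom_mul_mul_mem_range _ _)) (by rw [← map_mul, hef, map_zero])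
  have h4 (x : MatrixSum (fun i : {i | c i = j} => k i)) :
      ((φ ∘ blockHom V hV) ∘ extendByZero k {i | c i = j}) x =
        (φ ∘ extendByZero r {i | c i = j}) (jh x) :=
    congrArg φ (blockHom_extHom r {i | c i = j} V hV x)
  rw [h4, h4, h3]

theorem isSelfAdjoint_unit {κ : Type} (r : κ → ℕ) : IsSelfAdjoint (unit r) := star_unit

theorem exists_conjugate_matrixSum_into_hereditary {A B : Type*} [NonUnitalCStarAlgebra A]
    [PartialOrder A] [StarOrderedRing A] [NonUnitalCStarAlgebra B] {ι : B →⋆ₙₐ[ℂ] A}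
    (hι : Function.Injective ι)
    (hher : ∀ a b, 0 ≤ a → a ≤ ι b → a ∈ Set.range ι) {h : B} (hh : IsSelfAdjoint h)
    (hh1 : ‖h‖ ≤ 1) {κ : Type} [Fintype κ] {r : κ → ℕ} {θ : MatrixSum r →ₗ[ℂ] A} (hθ : IsCP θ)
    (hθ1 : ∀ x, ‖θ x‖ ≤ ‖x‖) (hθ0 : StrictOrderLE 0 θ) {β : ℝ} (hβ : 0 < β) (hβ1 : β ≤ 1)
    (hhu : ‖θ (unit r) - ι h * θ (unit r)‖ ≤ β ^ 8 / 4) :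
    ∃ z : A, (∀ y, z * y * star z ∈ Set.range ι) ∧ StrictOrderLE 0 (conjLinear z ∘ₗ θ) ∧
      ∀ x, 0 ≤ x → ‖conjLinear z (θ x) - θ x‖ ≤ 10 * β * ‖x‖ := by
  have : FiniteDimensional ℂ (MatrixSum r) := finiteDimensional_matrixSum r
  exact exists_conjugate_into_hereditary hι hher hh hh1 (F := MatrixSum r) (u := unit r)
    unit_mul (isSelfAdjoint_unit r) (unit_nonneg r) norm_unit_le hθ hθ1 hθ0 hβ hβ1 hhu

theorem exists_decomposable_mem_range {A B : Type*} [NonUnitalCStarAlgebra A] [PartialOrder A]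
    [StarOrderedRing A] [NonUnitalCStarAlgebra B] {n s : ℕ} {r : Fin s → ℕ} {ι : B →⋆ₙₐ[ℂ] A} (hι : Function.Injective ι)
    (hher : ∀ a b, 0 ≤ a → a ≤ ι b → a ∈ Set.range ι) {h : B} (hh : IsSelfAdjoint h)
    (hh1 : ‖h‖ ≤ 1) {Φ : MatrixSum r →ₗ[ℂ] A} (hΦ : IsCP Φ) (hΦ1 : ∀ x, ‖Φ x‖ ≤ ‖x‖)
    (hΦn : IsDecomposable n Φ) {β : ℝ} (hβ : 0 < β) (hβ1 : β ≤ 1)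
    (hhu : ∀ a, 0 ≤ a → a ≤ Φ (unit r) → ‖a - ι h * a‖ ≤ β ^ 8 / 4) :
    ∃ T : MatrixSum r →ₗ[ℂ] A, IsCP T ∧ (∀ x, T x ∈ LinearMap.range (ι : B →ₗ[ℂ] A)) ∧
      IsDecomposable n T ∧ ∀ x, 0 ≤ x → ‖(T - Φ) x‖ ≤ (n + 1) * (10 * β) * ‖x‖ := by
  obtain ⟨c, hc⟩ := hΦn
  let ext (j : Fin (n + 1)) := extHom r {i | c i = j}
  let res (j : Fin (n + 1)) := resHom r {i | c i = j}
  let θ (j : Fin (n + 1)) : MatrixSum (fun i : {i | c i = j} => r i) →ₗ[ℂ] A :=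
    Φ ∘ₗ (ext j : _ →ₗ[ℂ] MatrixSum r)
  have hθ (j) : IsCP (θ j) := hΦ.comp (isCP_starHom (ext j))
  have hθ1 (j) (x) : ‖θ j x‖ ≤ ‖x‖ :=
    (hΦ1 _).trans (NonUnitalStarAlgHom.norm_map (ext j) (extHom_injective _ _) x).le
  have hz (j : Fin (n + 1)) :=
    exists_conjugate_matrixSum_into_hereditary hι hher hh hh1 (hθ j) (hθ1 j) (hc j) hβ hβ1
      (hhu _ ((hθ j).nonneg (unit_nonneg _)) (hΦ.mono (extHom_unit_le r {i | c i = j})))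
  choose z hzB hz0 hzθ using hz
  -- Each colour has its own conjugating element; no relation between different colours is needed.
  let T : MatrixSum r →ₗ[ℂ] A :=
    ∑ j, conjLinear (z j) ∘ₗ θ j ∘ₗ (res j : MatrixSum r →ₗ[ℂ] _)
  have hT_apply (x) : T x = ∑ j, conjLinear (z j) (θ j (res j x)) := by
    simp [T, LinearMap.sum_apply]
  have hT : IsCP T := IsCP.sum _ fun j _ =>
    (isCP_conjLinear (z j)).comp ((hθ j).comp (isCP_starHom (res j)))
  have hTB (x) : T x ∈ LinearMap.range (ι : B →ₗ[ℂ] A) := by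
    rw [hT_apply]
    refine Submodule.sum_mem _ fun j _ => ?_
    rw [conjLinear_apply]
    exact hzB j _
  have hTΦ (x : MatrixSum r) (hx : 0 ≤ x) : ‖(T - Φ) x‖ ≤ (n + 1) * (10 * β) * ‖x‖ := by
    have h1 : Φ x = ∑ j, θ j (res j x) := by
      conv_lhs => rw [← sum_extHom_resHom r c x, map_sum]
      rfl
    rw [LinearMap.sub_apply, hT_apply, h1, ← Finset.sum_sub_distrib]
    refine (norm_sum_le _ _).trans ?_
    calc _ ≤ ∑ _j : Fin (n + 1), 10 * β * ‖x‖ := Finset.sum_le_sum fun j _ =>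
          (hzθ j _ (map_nonneg (res j) hx)).trans
            (by gcongr; exact NonUnitalStarAlgHom.norm_apply_le (res j) x)
      _ = (n + 1) * (10 * β) * ‖x‖ := by simp; ring
  refine ⟨T, hT, hTB, ⟨c, fun j => ?_⟩, hTΦ⟩
  have h4 (y) : (T ∘ extendByZero r {i | c i = j}) y = (conjLinear (z j) ∘ₗ θ j) y := by
    show T (ext j y) = _
    rw [hT_apply, Finset.sum_eq_single j]
    · simp only [res, ext, resHom_extHom, LinearMap.comp_apply]
    · intro j' _ hj'
      have hd : Disjoint {i | c i = j} {i | c i = j'} :=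
        Set.disjoint_left.2 fun i hi hi' => hj' (hi'.symm.trans hi)
      simp only [res, ext, resHom_extHom_of_disjoint r _ hd, map_zero]
    · simp
  rw [funext h4]
  exact hz0 j

theorem exists_decomposable_into_hereditary {ι : B →⋆ₙₐ[ℂ] A} (hι : Function.Injective ι)
    (hher : ∀ a b, 0 ≤ a → a ≤ ι b → a ∈ Set.range ι) {h : B} (hh : IsSelfAdjoint h)
    (hh1 : ‖h‖ ≤ 1) {Φ : MatrixSum r →ₗ[ℂ] A} (hΦ : IsCP Φ) (hΦ1 : ∀ x, ‖Φ x‖ ≤ ‖x‖)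
    (hΦn : IsDecomposable n Φ) {β : ℝ} (hβ : 0 < β) (hβ1 : β ≤ 1)
    (hhu : ∀ a, 0 ≤ a → a ≤ Φ (unit r) → ‖a - ι h * a‖ ≤ β ^ 8 / 4) :
    ∃ Ψ : MatrixSum r →ₗ[ℂ] B, IsCP Ψ ∧ (∀ x, ‖Ψ x‖ ≤ ‖x‖) ∧ IsDecomposable n Ψ ∧
      ∀ x, 0 ≤ x → ‖ι (Ψ x) - Φ x‖ ≤ 50 * (n + 1) * β * ‖x‖ := by
  obtain ⟨T, hT, hTB, hTdec, hTΦ⟩ :=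
    exists_decomposable_mem_range hι hher hh hh1 hΦ hΦ1 hΦn hβ hβ1 hhu
  set σ : ℝ := (n + 1) * (10 * β) with hσdef
  have hσ : 0 ≤ σ := by positivity
  -- Closeness to `Φ` is known only on positive elements; splitting into four positive parts costs
  -- the factor `4`. Dividing by `1 + 4 * σ` will restore contractivity.
  have hTn (x : MatrixSum r) : ‖T x‖ ≤ (1 + 4 * σ) * ‖x‖ := by
    have h1 := norm_le_of_nonneg_bound hσ hTΦ x
    calc ‖T x‖ = ‖(T - Φ) x + Φ x‖ := by simp
      _ ≤ 4 * σ * ‖x‖ + ‖x‖ := (norm_add_le _ _).trans (add_le_add h1 (hΦ1 x))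
      _ = _ := by ring
  let eB := LinearEquiv.ofInjective (ι : B →ₗ[ℂ] A) hι
  let TB : MatrixSum r →ₗ[ℂ] B := eB.symm.toLinearMap ∘ₗ T.codRestrict _ hTB
  have hTB_apply (x) : ι (TB x) = T x :=
    congrArg Subtype.val (eB.apply_symm_apply (T.codRestrict _ hTB x))
  have hTB_cp : IsCP TB := by
    refine IsCP.of_comp_injective ι hι ?_
    have : (ι : B →ₗ[ℂ] A) ∘ₗ TB = T := LinearMap.ext hTB_apply
    rwa [this]
  have hTBn (x : MatrixSum r) : ‖TB x‖ ≤ (1 + 4 * σ) * ‖x‖ := by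
    rw [← NonUnitalStarAlgHom.norm_map ι hι, hTB_apply]; exact hTn x
  let ρ : ℝ := (1 + 4 * σ)⁻¹
  have hρ : 0 ≤ ρ := by positivity
  have hρn (x : MatrixSum r) : ‖((ρ : ℂ) • TB) x‖ ≤ ‖x‖ := by
    rw [LinearMap.smul_apply, norm_smul, Complex.norm_real, Real.norm_of_nonneg hρ]
    calc ρ * ‖TB x‖ ≤ ρ * ((1 + 4 * σ) * ‖x‖) := by gcongr; exact hTBn x
      _ = ‖x‖ := by simp only [ρ]; field_simp
  have hcp : IsCP ((ρ : ℂ) • TB) := hTB_cp.smul hρ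
  refine ⟨(ρ : ℂ) • TB, hcp, hρn, ?_, fun x hx => ?_⟩
  · obtain ⟨c, hc⟩ := hTdec
    refine ⟨c, fun j => ?_⟩
    have h1 (x) (hx : IsSelfAdjoint x) :
        IsSelfAdjoint ((((ρ : ℂ) • TB) ∘ extendByZero r {i | c i = j}) x) :=
      hcp.isSelfAdjoint (hx.map (extHom r {i | c i = j}))
    have h2 (x) (hx : IsSelfAdjoint x) : IsSelfAdjoint ((T ∘ extendByZero r {i | c i = j}) x) :=
      hT.isSelfAdjoint (hx.map (extHom r {i | c i = j}))
    rw [strictOrderLE_zero_iff h1]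
    intro e f he hf hef
    have h3 := (strictOrderLE_zero_iff h2).1 (hc j) e f he hf hef
    have h4 (y) : ι ((((ρ : ℂ) • TB) ∘ extendByZero r {i | c i = j}) y) =
        (ρ : ℂ) • (T ∘ extendByZero r {i | c i = j}) y := by
      simp only [Function.comp_apply, LinearMap.smul_apply, map_smul, hTB_apply]
    apply hι
    rw [map_mul, map_zero, h4, h4, smul_mul_smul_comm, h3, smul_zero]
  · have h1 : ι (((ρ : ℂ) • TB) x) - Φ x = (T - Φ) x - (1 - ρ) • T x := by
      rw [LinearMap.smul_apply, map_smul, hTB_apply, LinearMap.sub_apply, sub_smul, one_smul,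
        Complex.coe_smul]
      abel
    have h2 : ‖(1 - ρ) • T x‖ ≤ 4 * σ * ‖x‖ := by
      have h3 : 1 - ρ = 4 * σ * ρ := by simp only [ρ]; field_simp; ring
      rw [h3, norm_smul, Real.norm_of_nonneg (by positivity)]
      calc 4 * σ * ρ * ‖T x‖ ≤ 4 * σ * ρ * ((1 + 4 * σ) * ‖x‖) := by gcongr; exact hTn x
        _ = 4 * σ * ‖x‖ := by simp only [ρ]; field_simp
    rw [h1]
    -- Conjugation costs `σ` and rescaling `4 * σ`; since `σ = 10 * (n + 1) * β`, this is where `50`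
    -- comes from.
    calc _ ≤ σ * ‖x‖ + 4 * σ * ‖x‖ := (norm_sub_le _ _).trans (add_le_add (hTΦ x hx) h2)
      _ = _ := by rw [hσdef]; ring

end

/-! ### Transferring approximations to the hereditary subalgebra -/

/-- `HasDecomposableApproximations` for an algebra that already carries its order. -/
def HasOrderedApproximations (A : Type*) [NonUnitalCStarAlgebra A] [PartialOrder A]
    [StarOrderedRing A] (n : ℕ) : Prop :=
  ∀ (S : Finset A) (ε : ℝ), 0 < ε →
    ∃ (s : ℕ) (r : Fin s → ℕ) (ψ : A →CP MatrixSum r) (φ : MatrixSum r →CP A),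
      (∀ a, ‖ψ a‖ ≤ ‖a‖) ∧ (∀ x, ‖φ x‖ ≤ ‖x‖) ∧ IsDecomposable n φ ∧
        ∀ b ∈ S, ‖φ (ψ b) - b‖ < ε

section

variable {A B : Type*} [NonUnitalCStarAlgebra A] [PartialOrder A] [StarOrderedRing A]
  [NonUnitalCStarAlgebra B] [PartialOrder B] [StarOrderedRing B] {n : ℕ}

/-- If `φ (ψ h)` is close to `h`, then elements below the image of a corner dominated by `ψ h` are
almost fixed by an almost unit of `h`. -/
theorem norm_sub_mul_le_of_le_image {a h q y : A} {κ δ : ℝ} (hκ : 0 < κ) (ha : 0 ≤ a)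
    (ha1 : ‖a‖ ≤ 1) (hay : κ • a ≤ y) (hq : IsSelfAdjoint q) (hq1 : ‖q‖ ≤ 1) {η : ℝ}
    (hqh : ‖h - q * h - h * q + q * h * q‖ ≤ η) (hy : ‖y - h‖ ≤ η) (hδ : 0 ≤ δ)
    (hη : 5 * η ≤ κ * δ ^ 2) : ‖a - q * a‖ ≤ δ := by
  have h1 : a ≤ κ⁻¹ • y := by
    have := smul_le_smul_of_nonneg_left hay (inv_nonneg.2 hκ.le)
    rwa [smul_smul, inv_mul_cancel₀ hκ.ne', one_smul] at this
  have h2 := norm_sub_mul_sq_le ha h1 hq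
  have h3 : κ⁻¹ • y - q * κ⁻¹ • y - κ⁻¹ • y * q + q * κ⁻¹ • y * q =
      κ⁻¹ • ((y - h - q * (y - h) - (y - h) * q + q * (y - h) * q) +
        (h - q * h - h * q + q * h * q)) := by
    simp only [mul_smul_comm, smul_mul_assoc, ← smul_sub, ← smul_add]
    congr 1
    noncomm_ring
  -- `5 = 4 + 1`: conjugating the error `y - h` by `1 - q` costs `4 * η`, and `h` itself contributes
  -- `η`.
  have h4 : ‖(y - h - q * (y - h) - (y - h) * q + q * (y - h) * q) +
        (h - q * h - h * q + q * h * q)‖ ≤ 5 * η :=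
    (norm_add_le _ _).trans (by linarith [norm_conjugate_sub_le hq1 (y - h)])
  rw [h3, norm_smul, Real.norm_of_nonneg (inv_nonneg.2 hκ.le)] at h2
  refine (pow_le_pow_iff_left₀ (norm_nonneg _) hδ two_ne_zero).1 (h2.trans ?_)
  calc _ ≤ 1 * (κ⁻¹ * (κ * δ ^ 2)) := by
        gcongr
        exact h4.trans hη
    _ = δ ^ 2 := by field_simp

theorem exists_approximation_of_nonneg {ι : B →⋆ₙₐ[ℂ] A} (hι : Function.Injective ι)
    (hher : ∀ a b, 0 ≤ a → a ≤ ι b → a ∈ Set.range ι) (hA : HasOrderedApproximations A n)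
    (S : Finset B) (hS : ∀ b ∈ S, 0 ≤ b) {η : ℝ} (hη : 0 < η) :
    ∃ (s : ℕ) (r : Fin s → ℕ) (ψ : B →CP MatrixSum r) (φ : MatrixSum r →CP B),
      (∀ a, ‖ψ a‖ ≤ ‖a‖) ∧ (∀ x, ‖φ x‖ ≤ ‖x‖) ∧ IsDecomposable n φ ∧
        ∀ b ∈ S, ‖φ (ψ b) - b‖ ≤ 3 * η := by
  classical
  let h : B := ∑ b ∈ S, b
  have hh : 0 ≤ h := Finset.sum_nonneg hS
  have hle (b) (hb : b ∈ S) : b ≤ h := Finset.single_le_sum hS hb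
  obtain ⟨M, hM, hhM⟩ : ∃ M : ℝ, 0 < M ∧ ‖h‖ ≤ M :=
    ⟨‖h‖ + 1, by positivity, by linarith⟩
  have hbM (b) (hb : b ∈ S) : ‖b‖ ≤ M :=
    (CStarAlgebra.norm_le_norm_of_nonneg_of_le (hS b hb) (hle b hb)).trans hhM
  -- `κ` bounds the loss from cutting to the corner, `β` that from conjugating into `B`. Both depend
  -- only on `h`, `η` and `n`, so the accuracy `τ` can be fixed in terms of them before `ψ` and `φ`
  -- are chosen.
  obtain ⟨κ, hκ, hκM⟩ : ∃ κ : ℝ, 0 < κ ∧ M * κ = (η / 2) ^ 2 :=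
    ⟨(η / 2) ^ 2 / M, by positivity, by field_simp⟩
  obtain ⟨β, hβ, hβ1, hβη⟩ : ∃ β : ℝ, 0 < β ∧ β ≤ 1 ∧ 50 * (n + 1) * β * M ≤ η := by
    refine ⟨min 1 (η / (50 * (n + 1) * M)), by positivity, min_le_left _ _, ?_⟩
    calc 50 * (n + 1) * min 1 (η / (50 * (n + 1) * M)) * M ≤
          50 * (n + 1) * (η / (50 * (n + 1) * M)) * M := by gcongr; exact min_le_right _ _
      _ = η := by field_simp
  obtain ⟨τ, hτ, hτη, hτκ⟩ : ∃ τ : ℝ, 0 < τ ∧ τ ≤ η ∧ 5 * τ ≤ κ * (β ^ 8 / 4) ^ 2 :=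
    ⟨min η (κ * (β ^ 8 / 4) ^ 2 / 5), by positivity, min_le_left _ _, by
      linarith [min_le_right η (κ * (β ^ 8 / 4) ^ 2 / 5)]⟩
  obtain ⟨q, hq, hq1, hqh⟩ := exists_almost_unit hh hτ
  -- `ι h` is included so that `φ (ψ (ι h))` is close to an element of `B`; this controls the image
  -- of the corner's unit.
  obtain ⟨s, r, ψ, φ, hψ1, hφ1, hφn, hψφ⟩ := hA (insert (ι h) (S.image ι)) τ hτ
  have hψ : IsCP (ψ : A →ₗ[ℂ] MatrixSum r) := isCP_coe ψ
  have hφ : IsCP (φ : MatrixSum r →ₗ[ℂ] A) := isCP_coe φ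
  have hψι : IsCP ((ψ : A →ₗ[ℂ] MatrixSum r) ∘ₗ (ι : B →ₗ[ℂ] A)) := hψ.comp (isCP_starHom ι)
  obtain ⟨k, V, hV, hpk, hpn⟩ := exists_corner (hψι.nonneg hh) hκ
  let j := blockHom V hV
  have hj : Function.Injective j := blockHom_injective V hV
  have hp_sa : IsSelfAdjoint (j (unit k)) := (isSelfAdjoint_unit k).map j
  have hp1 : ‖j (unit k)‖ ≤ 1 := by
    rw [NonUnitalStarAlgHom.norm_map j hj]; exact norm_unit_le
  let ψ' : B →ₗ[ℂ] MatrixSum k := compress V ∘ₗ (ψ : A →ₗ[ℂ] MatrixSum r) ∘ₗ (ι : B →ₗ[ℂ] A)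
  have hjψ' (b : B) : j (ψ' b) = j (unit k) * ψ (ι b) * j (unit k) :=
    blockHom_compress V hV (ψ (ι b))
  have hψ' : IsCP ψ' := by
    refine IsCP.of_comp_injective j hj ?_
    have h1 : (j : MatrixSum k →ₗ[ℂ] MatrixSum r) ∘ₗ ψ' =
        conjLinear (j (unit k)) ∘ₗ (ψ : A →ₗ[ℂ] MatrixSum r) ∘ₗ (ι : B →ₗ[ℂ] A) := by
      refine LinearMap.ext fun b => ?_
      simp only [LinearMap.comp_apply, conjLinear_apply, hp_sa.star_eq]
      exact hjψ' b
    rw [h1]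
    exact (isCP_conjLinear _).comp hψι
  have hψι1 (b : B) : ‖ψ (ι b)‖ ≤ ‖b‖ :=
    (hψ1 _).trans (NonUnitalStarAlgHom.norm_map ι hι b).le
  have hψ'1 (b : B) : ‖ψ' b‖ ≤ ‖b‖ := by
    rw [← NonUnitalStarAlgHom.norm_map j hj, hjψ']
    calc _ ≤ ‖j (unit k)‖ * ‖ψ (ι b)‖ * ‖j (unit k)‖ :=
          (norm_mul_le _ _).trans (by gcongr; exact norm_mul_le _ _)
      _ ≤ 1 * ‖b‖ * 1 := by gcongr; exact hψι1 b
      _ = ‖b‖ := by ring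
  let Φ : MatrixSum k →ₗ[ℂ] A :=
    (φ : MatrixSum r →ₗ[ℂ] A) ∘ₗ (j : MatrixSum k →ₗ[ℂ] MatrixSum r)
  have hΦ : IsCP Φ := hφ.comp (isCP_starHom j)
  have hΦ1 (x) : ‖Φ x‖ ≤ ‖x‖ := (hφ1 _).trans (NonUnitalStarAlgHom.norm_map j hj x).le
  have hΦn : IsDecomposable n Φ := hφn.comp_blockHom hφ V hV
  have hq1' : ‖ι q‖ ≤ 1 := by rwa [NonUnitalStarAlgHom.norm_map ι hι]
  have hqh' : ‖ι h - ι q * ι h - ι h * ι q + ι q * ι h * ι q‖ ≤ τ := by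
    simp only [← map_mul, ← map_sub, ← map_add]
    rwa [NonUnitalStarAlgHom.norm_map ι hι]
  have hΦu : κ • Φ (unit k) ≤ φ (ψ (ι h)) := by
    have hs : κ • j (unit k) = (κ : ℂ) • j (unit k) := by
      funext i
      ext a b
      exact Complex.real_smul
    have h1 := hφ.mono hpk
    rwa [show κ • blockHom V hV (unit k) = _ from hs, map_smul, Complex.coe_smul] at h1
  have hhu (a : A) (ha : 0 ≤ a) (hau : a ≤ Φ (unit k)) : ‖a - ι q * a‖ ≤ β ^ 8 / 4 := by
    have ha1 : ‖a‖ ≤ 1 := (CStarAlgebra.norm_le_norm_of_nonneg_of_le ha hau).trans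
      ((hΦ1 _).trans norm_unit_le)
    exact norm_sub_mul_le_of_le_image hκ ha ha1
      ((smul_le_smul_of_nonneg_left hau hκ.le).trans hΦu) (hq.map ι) hq1' hqh'
      (hψφ _ (Finset.mem_insert_self _ _)).le (by positivity) hτκ
  obtain ⟨Ψ, hΨ, hΨ1, hΨn, hΨΦ⟩ := exists_decomposable_into_hereditary hι hher hq hq1 hΦ hΦ1 hΦn
    hβ hβ1 hhu
  refine ⟨s, k, hψ'.toCP, hΨ.toCP, hψ'1, hΨ1, hΨn, fun b hb => ?_⟩
  rw [IsCP.toCP_apply, IsCP.toCP_apply, ← NonUnitalStarAlgHom.norm_map ι hι, map_sub]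
  have h1 : ‖ι (Ψ (ψ' b)) - Φ (ψ' b)‖ ≤ η := by
    refine (hΨΦ _ (hψ'.nonneg (hS b hb))).trans (le_trans ?_ hβη)
    gcongr
    exact (hψ'1 b).trans (hbM b hb)
  have h2 : ‖Φ (ψ' b) - φ (ψ (ι b))‖ ≤ η := by
    have hw0 : 0 ≤ ψ (ι b) := hψι.nonneg (hS b hb)
    have hwle : ψ (ι b) ≤ ψ (ι h) := hψι.mono (hle b hb)
    have h3 : Φ (ψ' b) - φ (ψ (ι b)) = φ (j (ψ' b) - ψ (ι b)) := (map_sub φ _ _).symm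
    have h4 := norm_sub_mul_sq_le hw0 hwle hp_sa
    -- The corner was chosen for `ψ (ι h)` but serves every `ψ (ι b)` below it, with error squared
    -- at most `M * κ = (η / 2) ^ 2`.
    have h5 : ‖ψ (ι b) - j (unit k) * ψ (ι b)‖ ≤ η / 2 := by
      refine (pow_le_pow_iff_left₀ (norm_nonneg _) (by positivity) two_ne_zero).1 (h4.trans ?_)
      rw [← hκM]
      exact mul_le_mul ((hψι1 b).trans (hbM b hb)) hpn (norm_nonneg _) hM.le
    rw [h3]
    refine (hφ1 _).trans ?_
    rw [hjψ', norm_sub_rev]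
    exact (norm_sub_mul_mul_le hw0.isSelfAdjoint hp_sa hp1).trans (by linarith)
  have h3 : ‖φ (ψ (ι b)) - ι b‖ ≤ η :=
    (hψφ _ (Finset.mem_insert_of_mem (Finset.mem_image_of_mem ι hb))).le.trans hτη
  calc _ = ‖(ι (Ψ (ψ' b)) - Φ (ψ' b)) + (Φ (ψ' b) - φ (ψ (ι b))) + (φ (ψ (ι b)) - ι b)‖ := by
        congr 1; abel
    _ ≤ η + η + η := (norm_add_le _ _).trans (add_le_add
        ((norm_add_le _ _).trans (add_le_add h1 h2)) h3)
    _ = 3 * η := by ring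

/-- Approximating the four positive parts of each `b` within `3 * ε / 16` approximates `b` within `3
* ε / 4`. -/
theorem HasOrderedApproximations.of_hereditary {ι : B →⋆ₙₐ[ℂ] A} (hι : Function.Injective ι)
    (hher : ∀ a b, 0 ≤ a → a ≤ ι b → a ∈ Set.range ι) (hA : HasOrderedApproximations A n) :
    HasOrderedApproximations B n := by
  classical
  intro S ε hε
  choose x hx0 _ hx using fun b : B => CStarAlgebra.exists_sum_four_nonneg b
  obtain ⟨s, r, ψ, φ, hψ, hφ, hφn, happ⟩ := exists_approximation_of_nonneg hι hher hA
    (S.biUnion fun b => Finset.univ.image (x b))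
    (by simp only [Finset.mem_biUnion, Finset.mem_image]
        rintro _ ⟨b, -, i, -, rfl⟩
        exact hx0 b i) (η := ε / 16) (by positivity)
  refine ⟨s, r, ψ, φ, hψ, hφ, hφn, fun b hb => ?_⟩
  have h1 : φ (ψ b) - b = ∑ i : Fin 4, Complex.I ^ (i : ℕ) • (φ (ψ (x b i)) - x b i) := by
    conv_lhs => rw [hx b]
    simp only [map_sum, map_smul, ← Finset.sum_sub_distrib, ← smul_sub]
  rw [h1]
  calc _ ≤ ∑ _i : Fin 4, 3 * (ε / 16) := by
        refine (norm_sum_le _ _).trans (Finset.sum_le_sum fun i _ => ?_)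
        rw [norm_smul, norm_pow, Complex.norm_I, one_pow, one_mul]
        exact happ _ (Finset.mem_biUnion.2
          ⟨b, hb, Finset.mem_image_of_mem _ (Finset.mem_univ i)⟩)
    _ = 3 / 4 * ε := by simp; ring
    _ < ε := by linarith

end

theorem HasDecomposableApproximations.of_isHereditary {A : Type*} [NonUnitalCStarAlgebra A]
    {B : NonUnitalStarSubalgebra ℂ A} [IsClosed (B : Set A)] (hB : IsHereditary B) {n : ℕ}
    (hA : HasDecomposableApproximations A n) : HasDecomposableApproximations B n := by
  let _ : PartialOrder A := CStarAlgebra.spectralOrder A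
  have : StarOrderedRing A := CStarAlgebra.spectralOrderedRing A
  let _ : PartialOrder B := CStarAlgebra.spectralOrder B
  have : StarOrderedRing B := CStarAlgebra.spectralOrderedRing B
  have hA' : HasOrderedApproximations A n := hA
  exact hA'.of_hereditary (B := B) (ι := NonUnitalStarSubalgebraClass.subtype B)
    Subtype.val_injective fun a b ha hab => ⟨⟨a, hB a b ha hab b.2⟩, rfl⟩

end DecompositionRank

end

theorem proposition3p10 {A : Type*} [NonUnitalCStarAlgebra A] [TopologicalSpace.SeparableSpace A]
    (B : NonUnitalStarSubalgebra ℂ A) [IsClosed (B : Set A)]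
    (hB : DecompositionRank.IsHereditary B) :
    DecompositionRank.decompositionRank B ≤ DecompositionRank.decompositionRank A := by
  exact le_iInf₂ fun n hn => iInf₂_le n (hn.of_isHereditary hB)
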